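/- A prop is a symmetric strict monoidal category whose objects are the natural numbers, with addition as monoidal product on objects; a prop morphism is an identity-on-objects symmetric strict monoidal functor. We write $;$ for composition in diagrammatic order, $\oplus$ for the monoidal product, $\mathrm{id}_n$ for identities and $\sigma_{m,n}\colon m+n\to n+m$ for symmetries. **The prop $\mathsf{Gauss}$.** Morphisms $m\to n$ are triples $(A,b,\Sigma)$ with $A\in\mathbb R^{n\times m}$, $b\in\mathbb R^n$ and $\Sigma\in\mathbb R^{n\times n}$ symmetric positive semidefinite, with $$(A,b,\Sigma);(C,d,\Xi)=(CA,\;Cb+d,\;C\Sigma C^{T}+\Xi),\qquad (A_1,b_1,\Sigma_1)\oplus(A_2,b_2,\Sigma_2)=\left(\begin{pmatrix}A_1&0\\0&A_2\end{pmatrix},\begin{pmatrix}b_1\\b_2\end{pmatrix},\begin{pmatrix}\Sigma_1&0\\0&\Sigma_2\end{pmatrix}\right);$$ identities are $(I,0,0)$ and the symmetry $m+n\to n+m$ is $(S,0,0)$ with $S(x,y)=(y,x)$. **The prop $\overrightarrow{\mathsf{GQA}}$ (causal graphical quadratic algebra).** It is the prop freely generated by the operations $$\mathrm{copy}\colon1\to2,\quad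 \mathrm{del}\colon1\to0,\quad \mathrm{add}\colon2\to1,\quad \mathrm{zero}\colon0\to1,\quad [k]\colon1\to1\ (k\in\mathbb R),\quad \mathrm{one}\colon0\to1,\quad \mathrm{normal}\colon0\to1$$ subject to the following equations, that is, terms modulo these equations and the laws of symmetric strict monoidal categories. Write $1$ for $\mathrm{id}_1$, $\sigma$ for $\sigma_{1,1}$, and $\tau=1\oplus\sigma\oplus 1\colon 4\to4$; here $k,l$ range over $\mathbb R$. * $(\mathrm{add}\oplus1);\mathrm{add}=(1\oplus\mathrm{add});\mathrm{add}$, $\ \sigma;\mathrm{add}=\mathrm{add}$, $\ (\mathrm{zero}\oplus1);\mathrm{add}=1$. * $\mathrm{copy};(\mathrm{copy}\oplus1)=\mathrm{copy};(1\oplus\mathrm{copy})$, $\ \mathrm{copy};\sigma=\mathrm{copy}$, $\ \mathrm{copy};(\mathrm{del}\oplus1)=1$. * $\mathrm{one};\mathrm{copy}=\mathrm{one}\oplus\mathrm{one}$, $\ \mathrm{one};\mathrm{del}=\mathrm{id}_0$. * $\mathrm{add};[k]=([k]\oplus[k]);\mathrm{add}$, $\ \mathrm{zero};[k]=\mathrm{zero}$,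 $\ [k];\mathrm{copy}=\mathrm{copy};([k]\oplus[k])$, $\ [k];\mathrm{del}=\mathrm{del}$. * $[k];[l]=[kl]$, $\ \mathrm{copy};([k]\oplus[l]);\mathrm{add}=[k+l]$, $\ [0]=\mathrm{del};\mathrm{zero}$, $\ [1]=1$. * $\mathrm{add};\mathrm{copy}=(\mathrm{copy}\oplus\mathrm{copy});\tau;(\mathrm{add}\oplus\mathrm{add})$, $\ \mathrm{zero};\mathrm{copy}=\mathrm{zero}\oplus\mathrm{zero}$, $\ \mathrm{zero};\mathrm{del}=\mathrm{id}_0$, $\ \mathrm{add};\mathrm{del}=\mathrm{del}\oplus\mathrm{del}$. * (D) $\ \mathrm{normal};\mathrm{del}=\mathrm{id}_0$. * (RI) $\ (\mathrm{normal}\oplus\mathrm{normal});R_\varphi=\mathrm{normal}\oplus\mathrm{normal}$ for all $\varphi\in[0,2\pi)$, where $$R_\varphi=(\mathrm{copy}\oplus\mathrm{copy});\tau;\Big(\big(([\cos\varphi]\oplus[-\sin\varphi]);\mathrm{add}\big)\oplus\big(([\sin\varphi]\oplus[\cos\varphi]);\mathrm{add}\big)\Big)\colon2\to2 .$$ **Theorem.**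 $\overrightarrow{\mathsf{GQA}}$ presents $\mathsf{Gauss}$. That is, there is a unique prop morphism $[\![\cdot]\!]\colon\overrightarrow{\mathsf{GQA}}\to\mathsf{Gauss}$ with $$[\![\mathrm{copy}]\!]=\left(\begin{pmatrix}1\\1\end{pmatrix},0,0\right),\quad [\![\mathrm{del}]\!]=((),(),()),\quad [\![\mathrm{add}]\!]=\left(\begin{pmatrix}1&1\end{pmatrix},0,0\right),\quad [\![\mathrm{zero}]\!]=((),0,0),$$ $$[\![[k]]\!]=((k),0,0),\quad [\![\mathrm{one}]\!]=((),1,0),\quad [\![\mathrm{normal}]\!]=((),0,1)$$ (where $()$ denotes the empty matrix or vector of the appropriate shape), and it is an isomorphism of props: it has an inverse prop morphism $\mathsf{Gauss}\to\overrightarrow{\mathsf{GQA}}$. -/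

import Mathlib

open scoped Matrix

/-- Transport of an element of an `ℕ × ℕ`-indexed family along equalities of the two indices. -/
def castHom {H : ℕ → ℕ → Type} {m m' n n' : ℕ} (hm : m = m') (hn : n = n') (f : H m n) :
    H m' n' :=
  match m', n', hm, hn with
  | _, _, rfl, rfl => f

/-- A prop: a symmetric strict monoidal category whose objects are the natural numbers, with
addition as monoidal product on objects. Composition is written in diagrammatic order.
Strictness is expressed by transporting morphisms along equalities of natural numbers. -/
structure PropCat where
  Hom : ℕ → ℕ → Type
  id : ∀ n, Hom n n
  comp : ∀ {m n k}, Hom m n → Hom n k → Hom m k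
  tensor : ∀ {m n m' n'}, Hom m n → Hom m' n' → Hom (m + m') (n + n')
  symm : ∀ m n, Hom (m + n) (n + m)
  comp_assoc : ∀ {m n k l} (f : Hom m n) (g : Hom n k) (h : Hom k l),
    comp (comp f g) h = comp f (comp g h)
  id_comp : ∀ {m n} (f : Hom m n), comp (id m) f = f
  comp_id : ∀ {m n} (f : Hom m n), comp f (id n) = f
  tensor_assoc : ∀ {m n m' n' m'' n''} (f : Hom m n) (g : Hom m' n') (h : Hom m'' n''),
    tensor (tensor f g) h =
      castHom (Nat.add_assoc m m' m'').symm (Nat.add_assoc n n' n'').symm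
        (tensor f (tensor g h))
  id_tensor : ∀ {m n} (f : Hom m n),
    tensor (id 0) f = castHom (Nat.zero_add m).symm (Nat.zero_add n).symm f
  tensor_id : ∀ {m n} (f : Hom m n),
    tensor f (id 0) = castHom (Nat.add_zero m).symm (Nat.add_zero n).symm f
  id_tensor_id : ∀ m n, tensor (id m) (id n) = id (m + n)
  interchange : ∀ {m n k m' n' k'} (f : Hom m n) (g : Hom n k) (f' : Hom m' n') (g' : Hom n' k'),
    tensor (comp f g) (comp f' g') = comp (tensor f f') (tensor g g')
  symm_natural : ∀ {m n m' n'} (f : Hom m n) (g : Hom m' n'),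
    comp (tensor f g) (symm n n') = comp (symm m m') (tensor g f)
  symm_symm : ∀ m n, comp (symm m n) (symm n m) = id (m + n)
  hexagon : ∀ m n k,
    castHom (Nat.add_assoc m n k).symm (Nat.add_assoc n k m) (symm m (n + k)) =
      comp (castHom rfl (Nat.add_assoc n m k) (tensor (symm m n) (id k)))
        (tensor (id n) (symm m k))

/-- Morphisms of props: identity-on-objects symmetric strict monoidal functors. -/
@[ext]
structure PropHom (C D : PropCat) where
  map : ∀ {m n}, C.Hom m n → D.Hom m n
  map_id : ∀ n, map (C.id n) = D.id n
  map_comp : ∀ {m n k} (f : C.Hom m n) (g : C.Hom n k),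
    map (C.comp f g) = D.comp (map f) (map g)
  map_tensor : ∀ {m n m' n'} (f : C.Hom m n) (g : C.Hom m' n'),
    map (C.tensor f g) = D.tensor (map f) (map g)
  map_symm : ∀ m n, map (C.symm m n) = D.symm m n

/-- A morphism of props is an isomorphism if it has a two-sided inverse morphism of props. -/
def PropHom.IsIso {C D : PropCat} (F : PropHom C D) : Prop :=
  ∃ G : PropHom D C,
    (∀ {m n} (f : C.Hom m n), G.map (F.map f) = f) ∧
    (∀ {m n} (g : D.Hom m n), F.map (G.map g) = g)

/-- Terms over a signature; `S m n` is the type of operations with arity `m` and coarity `n`. -/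
inductive Term (S : ℕ → ℕ → Type) : ℕ → ℕ → Type
  | gen {m n : ℕ} (o : S m n) : Term S m n
  | id (n : ℕ) : Term S n n
  | swap (m n : ℕ) : Term S (m + n) (n + m)
  | seq {m n k : ℕ} (c : Term S m n) (d : Term S n k) : Term S m k
  | par {m n m' n' : ℕ} (c : Term S m n) (d : Term S m' n') : Term S (m + m') (n + n')

/-- Sequential composition of terms, in diagrammatic order. -/
notation:65 c:65 " ⨾ " d:66 => (Term.seq c d :)
/-- Parallel composition of terms. -/
notation:75 c:75 " ⊞ₜ " d:76 => (Term.par c d :)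

/-- A symmetric monoidal theory: a signature and a set of equations between parallel terms. -/
structure SMT where
  Op : ℕ → ℕ → Type
  Eqn : ∀ {m n : ℕ}, Term Op m n → Term Op m n → Prop

namespace SMT

/-- Provable equality in a symmetric monoidal theory: the smallest congruence that contains
the equations of the theory and the laws of symmetric strict monoidal categories. -/
inductive Provable (T : SMT) : ∀ {m n : ℕ}, Term T.Op m n → Term T.Op m n → Prop
  | eqn {m n : ℕ} {c d : Term T.Op m n} (h : T.Eqn c d) : Provable T c d
  | refl {m n : ℕ} (c : Term T.Op m n) : Provable T c c
  | symm {m n : ℕ} {c d : Term T.Op m n} : Provable T c d → Provable T d c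
  | trans {m n : ℕ} {c d e : Term T.Op m n} : Provable T c d → Provable T d e → Provable T c e
  | seq_congr {m n k : ℕ} {c c' : Term T.Op m n} {d d' : Term T.Op n k} :
      Provable T c c' → Provable T d d' → Provable T (c ⨾ d) (c' ⨾ d')
  | par_congr {m n m' n' : ℕ} {c c' : Term T.Op m n} {d d' : Term T.Op m' n'} :
      Provable T c c' → Provable T d d' → Provable T (c ⊞ₜ d) (c' ⊞ₜ d')
  | seq_assoc {m n k l : ℕ} (c : Term T.Op m n) (d : Term T.Op n k) (e : Term T.Op k l) :
      Provable T (c ⨾ d ⨾ e) (c ⨾ (d ⨾ e))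
  | id_seq {m n : ℕ} (c : Term T.Op m n) : Provable T (.id m ⨾ c) c
  | seq_id {m n : ℕ} (c : Term T.Op m n) : Provable T (c ⨾ .id n) c
  | par_assoc {m n m' n' m'' n'' : ℕ} (c : Term T.Op m n) (d : Term T.Op m' n')
      (e : Term T.Op m'' n'') :
      Provable T (c ⊞ₜ d ⊞ₜ e)
        (castHom (Nat.add_assoc m m' m'').symm (Nat.add_assoc n n' n'').symm (c ⊞ₜ (d ⊞ₜ e)))
  | id_par {m n : ℕ} (c : Term T.Op m n) :
      Provable T (.id 0 ⊞ₜ c) (castHom (Nat.zero_add m).symm (Nat.zero_add n).symm c)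
  | par_id {m n : ℕ} (c : Term T.Op m n) :
      Provable T (c ⊞ₜ .id 0) (castHom (Nat.add_zero m).symm (Nat.add_zero n).symm c)
  | id_par_id (m n : ℕ) : Provable T (.id m ⊞ₜ .id n) (.id (m + n))
  | interchange {m n k m' n' k' : ℕ} (c : Term T.Op m n) (d : Term T.Op n k)
      (c' : Term T.Op m' n') (d' : Term T.Op n' k') :
      Provable T ((c ⨾ d) ⊞ₜ (c' ⨾ d')) (c ⊞ₜ c' ⨾ d ⊞ₜ d')
  | swap_natural {m n m' n' : ℕ} (c : Term T.Op m n) (d : Term T.Op m' n') :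
      Provable T (c ⊞ₜ d ⨾ .swap n n') (.swap m m' ⨾ d ⊞ₜ c)
  | swap_swap (m n : ℕ) : Provable T (.swap m n ⨾ .swap n m) (.id (m + n))
  | hexagon (m n k : ℕ) :
      Provable T
        (castHom (Nat.add_assoc m n k).symm (Nat.add_assoc n k m) (.swap m (n + k)))
        (castHom rfl (Nat.add_assoc n m k) (.swap m n ⊞ₜ .id k) ⨾ .id n ⊞ₜ .swap m k)

/-- Provable equality as a setoid on the terms of a given type. -/
def setoid (T : SMT) (m n : ℕ) : Setoid (Term T.Op m n) where
  r := Provable T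
  iseqv := ⟨Provable.refl, Provable.symm, Provable.trans⟩

/-- Morphisms of the free prop: terms modulo provable equality. -/
def FreeHom (T : SMT) (m n : ℕ) : Type := Quotient (T.setoid m n)

/-- The class of a term. -/
def FreeHom.mk (T : SMT) {m n : ℕ} (c : Term T.Op m n) : T.FreeHom m n :=
  Quotient.mk (T.setoid m n) c

theorem FreeHom.sound {T : SMT} {m n : ℕ} {c d : Term T.Op m n} (h : T.Provable c d) :
    FreeHom.mk T c = FreeHom.mk T d := Quotient.sound h

theorem FreeHom.castHom_mk {T : SMT} {m n m' n' : ℕ} (hm : m = m') (hn : n = n')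
    (c : Term T.Op m n) :
    castHom (H := T.FreeHom) hm hn (FreeHom.mk T c) = FreeHom.mk T (castHom hm hn c) := by
  subst hm hn; rfl

/-- Sequential composition in the free prop. -/
def FreeHom.comp {T : SMT} {m n k : ℕ} (f : T.FreeHom m n) (g : T.FreeHom n k) :
    T.FreeHom m k :=
  Quotient.liftOn₂ f g (fun c d => FreeHom.mk T (c ⨾ d))
    fun _ _ _ _ h h' => FreeHom.sound (.seq_congr h h')

/-- Parallel composition in the free prop. -/
def FreeHom.tensor {T : SMT} {m n m' n' : ℕ} (f : T.FreeHom m n) (g : T.FreeHom m' n') :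
    T.FreeHom (m + m') (n + n') :=
  Quotient.liftOn₂ f g (fun c d => FreeHom.mk T (c ⊞ₜ d))
    fun _ _ _ _ h h' => FreeHom.sound (.par_congr h h')

/-- The prop freely generated by a symmetric monoidal theory. -/
def freeProp (T : SMT) : PropCat where
  Hom := T.FreeHom
  id n := FreeHom.mk T (.id n)
  comp := FreeHom.comp
  tensor := FreeHom.tensor
  symm m n := FreeHom.mk T (.swap m n)
  comp_assoc := by
    rintro m n k l ⟨f⟩ ⟨g⟩ ⟨h⟩
    exact FreeHom.sound (.seq_assoc f g h)
  id_comp := by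
    rintro m n ⟨f⟩
    exact FreeHom.sound (.id_seq f)
  comp_id := by
    rintro m n ⟨f⟩
    exact FreeHom.sound (.seq_id f)
  tensor_assoc := by
    rintro m n m' n' m'' n'' ⟨f⟩ ⟨g⟩ ⟨h⟩
    exact (FreeHom.sound (.par_assoc f g h)).trans (FreeHom.castHom_mk _ _ _).symm
  id_tensor := by
    rintro m n ⟨f⟩
    exact (FreeHom.sound (.id_par f)).trans (FreeHom.castHom_mk _ _ _).symm
  tensor_id := by
    rintro m n ⟨f⟩
    exact (FreeHom.sound (.par_id f)).trans (FreeHom.castHom_mk _ _ _).symm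
  id_tensor_id m n := FreeHom.sound (.id_par_id m n)
  interchange := by
    rintro m n k m' n' k' ⟨f⟩ ⟨g⟩ ⟨f'⟩ ⟨g'⟩
    exact FreeHom.sound (.interchange f g f' g')
  symm_natural := by
    rintro m n m' n' ⟨f⟩ ⟨g⟩
    exact FreeHom.sound (.swap_natural f g)
  symm_symm m n := FreeHom.sound (.swap_swap m n)
  hexagon m n k := by
    have h1 := FreeHom.castHom_mk (T := T) (Nat.add_assoc m n k).symm (Nat.add_assoc n k m)
      (.swap m (n + k))
    have h2 := FreeHom.castHom_mk (T := T) rfl (Nat.add_assoc n m k) (.swap m n ⊞ₜ .id k)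
    refine h1.trans ((FreeHom.sound (.hexagon m n k)).trans ?_)
    exact congrArg
      (fun x => FreeHom.comp x (FreeHom.mk T (.id n ⊞ₜ .swap m k))) h2.symm

end SMT

/-- A Gaussian map `m → n`, informally `x ↦ A x + 𝒩(b, Σ)`. -/
@[ext]
structure GaussMap (m n : ℕ) where
  A : Matrix (Fin n) (Fin m) ℝ
  b : Fin n → ℝ
  cov : Matrix (Fin n) (Fin n) ℝ
  posSemidef : cov.PosSemidef

/-- The block matrix with diagonal blocks `M`, `N` and zeros elsewhere. -/
def directSum {m n m' n' : ℕ} (M : Matrix (Fin n) (Fin m) ℝ) (N : Matrix (Fin n') (Fin m') ℝ) :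
    Matrix (Fin (n + n')) (Fin (m + m')) ℝ :=
  (Matrix.fromBlocks M 0 0 N).submatrix finSumFinEquiv.symm finSumFinEquiv.symm

/-- The matrix of the block exchange `(x, y) ↦ (y, x)` from `ℝ^(m + n)` to `ℝ^(n + m)`. -/
def swapMatrix (m n : ℕ) : Matrix (Fin (n + m)) (Fin (m + n)) ℝ :=
  (Matrix.fromBlocks (0 : Matrix (Fin n) (Fin m) ℝ) 1 1 0).submatrix
    finSumFinEquiv.symm finSumFinEquiv.symm

section blocks

variable {m n m' n' : ℕ} (M : Matrix (Fin n) (Fin m) ℝ) (N : Matrix (Fin n') (Fin m') ℝ)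

@[simp] theorem directSum_ll (i : Fin n) (j : Fin m) :
    directSum M N (Fin.castAdd n' i) (Fin.castAdd m' j) = M i j := by simp [directSum]

@[simp] theorem directSum_lr (i : Fin n) (j : Fin m') :
    directSum M N (Fin.castAdd n' i) (Fin.natAdd m j) = 0 := by simp [directSum]

@[simp] theorem directSum_rl (i : Fin n') (j : Fin m) :
    directSum M N (Fin.natAdd n i) (Fin.castAdd m' j) = 0 := by simp [directSum]

@[simp] theorem directSum_rr (i : Fin n') (j : Fin m') :
    directSum M N (Fin.natAdd n i) (Fin.natAdd m j) = N i j := by simp [directSum]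

theorem swapMatrix_ll (m n : ℕ) (i : Fin n) (j : Fin m) :
    swapMatrix m n (Fin.castAdd m i) (Fin.castAdd n j) = 0 := by simp [swapMatrix]

theorem swapMatrix_lr (m n : ℕ) (i j : Fin n) :
    swapMatrix m n (Fin.castAdd m i) (Fin.natAdd m j) = (1 : Matrix _ _ ℝ) i j := by
  simp [swapMatrix]

theorem swapMatrix_rl (m n : ℕ) (i j : Fin m) :
    swapMatrix m n (Fin.natAdd n i) (Fin.castAdd n j) = (1 : Matrix _ _ ℝ) i j := by
  simp [swapMatrix]

theorem swapMatrix_rr (m n : ℕ) (i : Fin m) (j : Fin n) :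
    swapMatrix m n (Fin.natAdd n i) (Fin.natAdd m j) = 0 := by simp [swapMatrix]

theorem fin_add_forall {m n : ℕ} {p : Fin (m + n) → Prop} :
    (∀ i, p i) ↔ (∀ i, p (Fin.castAdd n i)) ∧ ∀ i, p (Fin.natAdd m i) :=
  ⟨fun h => ⟨fun _ => h _, fun _ => h _⟩, fun h i => Fin.addCases h.1 h.2 i⟩

theorem directSum_posSemidef {m n : ℕ} {M : Matrix (Fin m) (Fin m) ℝ}
    {N : Matrix (Fin n) (Fin n) ℝ} (hM : M.PosSemidef) (hN : N.PosSemidef) :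
    (directSum M N).PosSemidef := by
  refine Matrix.PosSemidef.submatrix ?_ _
  refine .of_dotProduct_mulVec_nonneg ?_ fun x => ?_
  · exact Matrix.IsHermitian.fromBlocks hM.1 (by simp) hN.1
  · have h1 := hM.dotProduct_mulVec_nonneg (x ∘ Sum.inl)
    have h2 := hN.dotProduct_mulVec_nonneg (x ∘ Sum.inr)
    rw [Matrix.fromBlocks_mulVec, Matrix.dotProduct_block]
    simpa using add_nonneg h1 h2

end blocks

namespace GaussMap

/-- The deterministic Gaussian map `x ↦ A x + b`. -/
def ofAffine {m n : ℕ} (A : Matrix (Fin n) (Fin m) ℝ) (b : Fin n → ℝ) : GaussMap m n :=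
  ⟨A, b, 0, Matrix.PosSemidef.zero⟩

/-- `(A, b, Σ) ; (C, d, Ξ) = (C A, C b + d, C Σ Cᵀ + Ξ)`. -/
def comp {m n k : ℕ} (f : GaussMap m n) (g : GaussMap n k) : GaussMap m k where
  A := g.A * f.A
  b := g.A *ᵥ f.b + g.b
  cov := g.A * f.cov * g.Aᵀ + g.cov
  posSemidef := by
    have h := f.posSemidef.mul_mul_conjTranspose_same g.A
    rw [Matrix.conjTranspose_eq_transpose_of_trivial] at h
    exact h.add g.posSemidef

/-- Componentwise direct sum of Gaussian maps. -/
def tensor {m n m' n' : ℕ} (f : GaussMap m n) (g : GaussMap m' n') :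
    GaussMap (m + m') (n + n') where
  A := directSum f.A g.A
  b := Fin.append f.b g.b
  cov := directSum f.cov g.cov
  posSemidef := directSum_posSemidef f.posSemidef g.posSemidef

theorem castHom_A {m m' n n' : ℕ} (hm : m = m') (hn : n = n') (f : GaussMap m n) :
    (castHom hm hn f).A = f.A.submatrix (Fin.cast hn.symm) (Fin.cast hm.symm) := by
  subst hm hn; rfl

theorem castHom_b {m m' n n' : ℕ} (hm : m = m') (hn : n = n') (f : GaussMap m n) :
    (castHom hm hn f).b = f.b ∘ Fin.cast hn.symm := by
  subst hm hn; rfl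

theorem castHom_cov {m m' n n' : ℕ} (hm : m = m') (hn : n = n') (f : GaussMap m n) :
    (castHom hm hn f).cov = f.cov.submatrix (Fin.cast hn.symm) (Fin.cast hn.symm) := by
  subst hm hn; rfl

end GaussMap

theorem directSum_mul {m n k m' n' k' : ℕ} (M : Matrix (Fin n) (Fin m) ℝ)
    (N : Matrix (Fin n') (Fin m') ℝ) (P : Matrix (Fin m) (Fin k) ℝ)
    (Q : Matrix (Fin m') (Fin k') ℝ) :
    directSum M N * directSum P Q = directSum (M * P) (N * Q) := by
  ext i j
  revert i j
  simp [fin_add_forall, Matrix.mul_apply, Fin.sum_univ_add]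

theorem directSum_add {m n m' n' : ℕ} (M P : Matrix (Fin n) (Fin m) ℝ)
    (N Q : Matrix (Fin n') (Fin m') ℝ) :
    directSum M N + directSum P Q = directSum (M + P) (N + Q) := by
  ext i j
  revert i j
  simp [fin_add_forall]

theorem directSum_transpose {m n m' n' : ℕ} (M : Matrix (Fin n) (Fin m) ℝ)
    (N : Matrix (Fin n') (Fin m') ℝ) :
    (directSum M N)ᵀ = directSum Mᵀ Nᵀ := by
  ext i j
  revert i j
  simp [fin_add_forall]

theorem directSum_mulVec {m n m' n' : ℕ} (M : Matrix (Fin n) (Fin m) ℝ)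
    (N : Matrix (Fin n') (Fin m') ℝ) (v : Fin m → ℝ) (w : Fin m' → ℝ) :
    directSum M N *ᵥ Fin.append v w = Fin.append (M *ᵥ v) (N *ᵥ w) := by
  ext i
  revert i
  simp [fin_add_forall, Matrix.mulVec, dotProduct, Fin.sum_univ_add]

theorem append_add {m n : ℕ} (v v' : Fin m → ℝ) (w w' : Fin n → ℝ) :
    Fin.append v w + Fin.append v' w' = Fin.append (v + v') (w + w') := by
  ext i
  revert i
  simp [fin_add_forall]

theorem directSum_one (m n : ℕ) :
    directSum (1 : Matrix (Fin m) (Fin m) ℝ) (1 : Matrix (Fin n) (Fin n) ℝ) = 1 := by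
  simp [directSum]

theorem directSum_zero (m n m' n' : ℕ) :
    directSum (0 : Matrix (Fin n) (Fin m) ℝ) (0 : Matrix (Fin n') (Fin m') ℝ) = 0 := by
  simp [directSum]

theorem directSum_assoc {m n m' n' m'' n'' : ℕ} (M : Matrix (Fin n) (Fin m) ℝ)
    (N : Matrix (Fin n') (Fin m') ℝ) (P : Matrix (Fin n'') (Fin m'') ℝ) :
    directSum (directSum M N) P = (directSum M (directSum N P)).submatrix
      (Fin.cast (Nat.add_assoc n n' n'')) (Fin.cast (Nat.add_assoc m m' m'')) := by
  ext i j
  have e1 : ∀ {a b c : ℕ} (i : Fin a), Fin.cast (Nat.add_assoc a b c)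
    (Fin.castAdd c (Fin.castAdd b i)) = Fin.castAdd (b + c) i := fun i => rfl
  have e2 : ∀ {a b c : ℕ} (i : Fin b), Fin.cast (Nat.add_assoc a b c)
    (Fin.castAdd c (Fin.natAdd a i)) = Fin.natAdd a (Fin.castAdd c i) := fun i => rfl
  have e3 : ∀ {a b c : ℕ} (i : Fin c), Fin.cast (Nat.add_assoc a b c)
    (Fin.natAdd (a + b) i) = Fin.natAdd a (Fin.natAdd b i) := fun i => by
      ext; simp [Nat.add_assoc]
  revert i j
  simp only [fin_add_forall, Matrix.submatrix_apply, e1, e2, e3]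
  simp

theorem directSum_empty_left {m n : ℕ} (E : Matrix (Fin 0) (Fin 0) ℝ)
    (M : Matrix (Fin n) (Fin m) ℝ) :
    directSum E M = M.submatrix (Fin.cast (Nat.zero_add n)) (Fin.cast (Nat.zero_add m)) := by
  ext i j
  have e : ∀ {a : ℕ} (i : Fin a), Fin.cast (Nat.zero_add a) (Fin.natAdd 0 i) = i :=
    fun i => by ext; simp
  revert i j
  simp only [fin_add_forall, Matrix.submatrix_apply, e, directSum_rr]
  simp

theorem directSum_empty_right {m n : ℕ} (E : Matrix (Fin 0) (Fin 0) ℝ)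
    (M : Matrix (Fin n) (Fin m) ℝ) : directSum M E = M := by
  ext i j
  have e : ∀ {a : ℕ} (i : Fin a), Fin.castAdd 0 i = i := fun i => rfl
  have := directSum_ll M E i j
  rwa [e, e] at this

theorem swapMatrix_mul {m n m' n' : ℕ} (M : Matrix (Fin n) (Fin m) ℝ)
    (N : Matrix (Fin n') (Fin m') ℝ) :
    swapMatrix n n' * directSum M N = directSum N M * swapMatrix m m' := by
  ext i j
  revert i j
  simp [fin_add_forall, Matrix.mul_apply, Fin.sum_univ_add, swapMatrix_ll, swapMatrix_lr,
    swapMatrix_rl, swapMatrix_rr, Matrix.one_apply]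

theorem swapMatrix_mulVec {m n : ℕ} (v : Fin m → ℝ) (w : Fin n → ℝ) :
    swapMatrix m n *ᵥ Fin.append v w = Fin.append w v := by
  ext i
  revert i
  simp [fin_add_forall, Matrix.mulVec, dotProduct, Fin.sum_univ_add, swapMatrix_ll,
    swapMatrix_lr, swapMatrix_rl, swapMatrix_rr, Matrix.one_apply]

theorem swapMatrix_mul_swapMatrix (m n : ℕ) : swapMatrix n m * swapMatrix m n = 1 := by
  ext i j
  revert i j
  have h1 : ∀ (i : Fin m) (j : Fin n), Fin.castAdd n i ≠ Fin.natAdd m j := fun i j h => by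
    have := congrArg Fin.val h
    simp at this
    omega
  simp [fin_add_forall, Matrix.mul_apply, Fin.sum_univ_add, swapMatrix_ll, swapMatrix_lr,
    swapMatrix_rl, swapMatrix_rr, Matrix.one_apply, h1, fun i j => (h1 i j).symm]

theorem swapMatrix_transpose (m n : ℕ) : (swapMatrix m n)ᵀ = swapMatrix n m := by
  ext i j
  revert i j
  simp [fin_add_forall, swapMatrix_ll, swapMatrix_lr,
    swapMatrix_rl, swapMatrix_rr, Matrix.one_apply, eq_comm]

theorem swapMatrix_hexagon (m n k : ℕ) :
    (swapMatrix m (n + k)).submatrix (Fin.cast (Nat.add_assoc n k m).symm)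
        (Fin.cast (Nat.add_assoc m n k)) =
      directSum (1 : Matrix (Fin n) (Fin n) ℝ) (swapMatrix m k) *
        (directSum (swapMatrix m n) (1 : Matrix (Fin k) (Fin k) ℝ)).submatrix
          (Fin.cast (Nat.add_assoc n m k).symm) id := by
  ext i j
  have e1 : ∀ {a b c : ℕ} (i : Fin a), Fin.cast (Nat.add_assoc a b c)
    (Fin.castAdd c (Fin.castAdd b i)) = Fin.castAdd (b + c) i := fun i => rfl
  have e2 : ∀ {a b c : ℕ} (i : Fin b), Fin.cast (Nat.add_assoc a b c)
    (Fin.castAdd c (Fin.natAdd a i)) = Fin.natAdd a (Fin.castAdd c i) := fun i => rfl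
  have e3 : ∀ {a b c : ℕ} (i : Fin c), Fin.cast (Nat.add_assoc a b c)
    (Fin.natAdd (a + b) i) = Fin.natAdd a (Fin.natAdd b i) := fun i => by
      ext; simp [Nat.add_assoc]
  have d1 : ∀ {a b c : ℕ} (i : Fin a), Fin.cast (Nat.add_assoc a b c).symm
    (Fin.castAdd (b + c) i) = Fin.castAdd c (Fin.castAdd b i) := fun i => rfl
  have d2 : ∀ {a b c : ℕ} (i : Fin b), Fin.cast (Nat.add_assoc a b c).symm
    (Fin.natAdd a (Fin.castAdd c i)) = Fin.castAdd c (Fin.natAdd a i) := fun i => rfl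
  have d3 : ∀ {a b c : ℕ} (i : Fin c), Fin.cast (Nat.add_assoc a b c).symm
    (Fin.natAdd a (Fin.natAdd b i)) = Fin.natAdd (a + b) i := fun i => by
      ext; simp [Nat.add_assoc]
  have n1 : ∀ {a b : ℕ} (i : Fin a) (j : Fin b), Fin.castAdd b i ≠ Fin.natAdd a j :=
    fun i j h => by
      have := congrArg Fin.val h
      simp at this
      omega
  revert i j
  simp only [fin_add_forall, Matrix.submatrix_apply, Matrix.mul_apply, Fin.sum_univ_add,
    e1, e2, e3, d1, d2, d3, id]
  simp [swapMatrix_ll, swapMatrix_lr, swapMatrix_rl, swapMatrix_rr, Matrix.one_apply, n1,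
    fun {a b : ℕ} (i : Fin a) (j : Fin b) => (n1 i j).symm]

theorem append_assoc_cast {n n' n'' : ℕ} (u : Fin n → ℝ) (v : Fin n' → ℝ) (w : Fin n'' → ℝ) :
    Fin.append (Fin.append u v) w =
      Fin.append u (Fin.append v w) ∘ Fin.cast (Nat.add_assoc n n' n'') :=
  Fin.append_assoc u v w

/-- The prop `Gauss` of Gaussian maps. -/
def gauss : PropCat where
  Hom := GaussMap
  id n := .ofAffine 1 0
  comp := GaussMap.comp
  tensor := GaussMap.tensor
  symm m n := .ofAffine (swapMatrix m n) 0
  comp_assoc f g h := by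
    ext1 <;> simp [GaussMap.comp, Matrix.mul_assoc, Matrix.mul_add, Matrix.add_mul,
      Matrix.mulVec_add, Matrix.transpose_mul, add_assoc]
  id_comp f := by
    ext1 <;> simp [GaussMap.comp, GaussMap.ofAffine]
  comp_id f := by
    ext1 <;> simp [GaussMap.comp, GaussMap.ofAffine]
  tensor_assoc f g h := by
    ext1
    · rw [GaussMap.castHom_A]; exact directSum_assoc _ _ _
    · rw [GaussMap.castHom_b]; exact append_assoc_cast _ _ _
    · rw [GaussMap.castHom_cov]; exact directSum_assoc _ _ _
  id_tensor f := by
    ext1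
    · rw [GaussMap.castHom_A]; exact directSum_empty_left _ _
    · rw [GaussMap.castHom_b]; exact Fin.append_left_nil (0 : Fin 0 → ℝ) _ rfl
    · rw [GaussMap.castHom_cov]; exact directSum_empty_left _ _
  tensor_id f := by
    ext1
    · rw [GaussMap.castHom_A]; exact directSum_empty_right _ _
    · rw [GaussMap.castHom_b]; exact Fin.append_right_nil _ _ rfl
    · rw [GaussMap.castHom_cov]; exact directSum_empty_right _ _
  id_tensor_id m n := by
    ext1
    · exact directSum_one m n
    · ext i
      revert i
      simp [fin_add_forall, GaussMap.tensor, GaussMap.ofAffine]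
    · exact directSum_zero _ _ _ _
  interchange f g f' g' := by
    ext1 <;> simp [GaussMap.comp, GaussMap.tensor, directSum_mul, directSum_add,
      directSum_transpose, directSum_mulVec, append_add]
  symm_natural f g := by
    ext1 <;> simp [GaussMap.comp, GaussMap.tensor, GaussMap.ofAffine, swapMatrix_mul,
      swapMatrix_mulVec, swapMatrix_transpose, Matrix.mul_assoc, swapMatrix_mul_swapMatrix]
  symm_symm m n := by
    ext1 <;> simp [GaussMap.comp, GaussMap.ofAffine, swapMatrix_mul_swapMatrix]
  hexagon m n k := by
    have h0 : ∀ a b : ℕ, Fin.append (0 : Fin a → ℝ) (0 : Fin b → ℝ) = 0 := fun a b => by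
      ext i; revert i; simp [fin_add_forall]
    ext1
    · simp only [GaussMap.comp, GaussMap.castHom_A]
      exact swapMatrix_hexagon m n k
    · simp [GaussMap.comp, GaussMap.castHom_b, GaussMap.tensor, GaussMap.ofAffine, h0]
    · simp [GaussMap.comp, GaussMap.castHom_cov, GaussMap.tensor, GaussMap.ofAffine,
        directSum_zero]

/-- The generators of causal graphical quadratic algebra. -/
inductive CausalOp : ℕ → ℕ → Type
  | copy : CausalOp 1 2
  | discard : CausalOp 1 0
  | add : CausalOp 2 1
  | zero : CausalOp 0 1
  | scalar (k : ℝ) : CausalOp 1 1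
  | one : CausalOp 0 1
  | normal : CausalOp 0 1

namespace CausalGQA

/-- Terms over the generators of causal graphical quadratic algebra. -/
abbrev Tm (m n : ℕ) : Type := Term CausalOp m n

def copy : Tm 1 2 := .gen .copy
def discard : Tm 1 0 := .gen .discard
def add : Tm 2 1 := .gen .add
def zero : Tm 0 1 := .gen .zero
def scalar (k : ℝ) : Tm 1 1 := .gen (.scalar k)
def one : Tm 0 1 := .gen .one
def normal : Tm 0 1 := .gen .normal

/-- A single wire. -/
def wire : Tm 1 1 := .id 1
/-- The empty diagram. -/
def empty : Tm 0 0 := .id 0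
/-- The crossing of two wires. -/
def cross : Tm 2 2 := .swap 1 1
/-- The crossing of the two middle wires among four. -/
def crossMid : Tm 4 4 := wire ⊞ₜ cross ⊞ₜ wire

/-- The diagram of the `2 × 2` matrix with rows `(a, b)` and `(c, d)`. -/
def mat2 (a b c d : ℝ) : Tm 2 2 :=
  copy ⊞ₜ copy ⨾ crossMid ⨾
    (scalar a ⊞ₜ scalar b ⨾ add) ⊞ₜ (scalar c ⊞ₜ scalar d ⨾ add)

/-- The axioms of causal graphical quadratic algebra. -/
inductive Ax : ∀ {m n : ℕ}, Tm m n → Tm m n → Prop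
  -- addition and zero form a commutative monoid
  | add_assoc : Ax (add ⊞ₜ wire ⨾ add) (wire ⊞ₜ add ⨾ add)
  | add_comm : Ax (cross ⨾ add) add
  | add_unit : Ax (zero ⊞ₜ wire ⨾ add) wire
  -- copying and discarding form a cocommutative comonoid
  | copy_coassoc : Ax (copy ⨾ copy ⊞ₜ wire) (copy ⨾ wire ⊞ₜ copy)
  | copy_cocomm : Ax (copy ⨾ cross) copy
  | copy_counit : Ax (copy ⨾ discard ⊞ₜ wire) wire
  -- the constant one is copied and discarded
  | one_dup : Ax (one ⨾ copy) (one ⊞ₜ one)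
  | one_del : Ax (one ⨾ discard) empty
  -- scalars distribute over both structures
  | scalar_add (k : ℝ) : Ax (add ⨾ scalar k) (scalar k ⊞ₜ scalar k ⨾ add)
  | scalar_zero (k : ℝ) : Ax (zero ⨾ scalar k) zero
  | scalar_dup (k : ℝ) : Ax (scalar k ⨾ copy) (copy ⨾ scalar k ⊞ₜ scalar k)
  | scalar_del (k : ℝ) : Ax (scalar k ⨾ discard) discard
  -- the field structure of the reals
  | mult (k l : ℝ) : Ax (scalar k ⨾ scalar l) (scalar (k * l))
  | plus (k l : ℝ) : Ax (copy ⨾ scalar k ⊞ₜ scalar l ⨾ add) (scalar (k + l))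
  | zero_scalar : Ax (scalar 0) (discard ⨾ zero)
  | one_scalar : Ax (scalar 1) wire
  -- the laws of bimonoids
  | bimonoid : Ax (add ⨾ copy) (copy ⊞ₜ copy ⨾ crossMid ⨾ add ⊞ₜ add)
  | zero_dup : Ax (zero ⨾ copy) (zero ⊞ₜ zero)
  | zero_del : Ax (zero ⨾ discard) empty
  | add_del : Ax (add ⨾ discard) (discard ⊞ₜ discard)
  -- the standard normal generator is discardable and invariant under rotations of the plane
  | normal_del : Ax (normal ⨾ discard) empty
  | normal_rot (φ : ℝ) (hφ : φ ∈ Set.Ico 0 (2 * Real.pi)) :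
      Ax (normal ⊞ₜ normal ⨾ mat2 (Real.cos φ) (-Real.sin φ) (Real.sin φ) (Real.cos φ))
        (normal ⊞ₜ normal)

end CausalGQA

/-- The symmetric monoidal theory of causal graphical quadratic algebra. -/
def causalGQA : SMT where
  Op := CausalOp
  Eqn := CausalGQA.Ax

/-- The interpretation of the generators as Gaussian maps. -/
def gaussInterp : ∀ {m n : ℕ}, CausalOp m n → GaussMap m n
  | _, _, .copy => .ofAffine !![1; 1] 0
  | _, _, .discard => .ofAffine 0 0
  | _, _, .add => .ofAffine !![1, 1] 0
  | _, _, .zero => .ofAffine 0 0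
  | _, _, .scalar k => .ofAffine !![k] 0
  | _, _, .one => .ofAffine 0 ![1]
  | _, _, .normal => ⟨0, 0, 1, Matrix.PosSemidef.one⟩

/-- `F` extends an assignment `v` of the generators of the theory `T` to morphisms of `C`. -/
def PropHom.Extends {T : SMT} {C : PropCat} (F : PropHom T.freeProp C)
    (v : ∀ {m n : ℕ}, T.Op m n → C.Hom m n) : Prop :=
  ∀ {m n : ℕ} (o : T.Op m n), F.map (SMT.FreeHom.mk T (.gen o)) = v o

/-!
The interpretation of causal graphical quadratic algebra in Gaussian maps is well defined because
the axioms hold for Gaussian maps (`den_eq_of_ax`). It is an isomorphism because it is bijective on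
morphisms (`sem_injective`, `sem_surjective`), and morphisms of props out of a free prop are
determined by the generators.

Completeness is first proved without noise. A morphism is called deterministic (`IsDet`) if it can
be copied and discarded, and if precomposition with it acts on the affine functionals
`row β s : n → 1`, which stand for `x ↦ β + ∑ i, s i * x i`, in the way that the affine map which
it denotes does. All generators but `normal` have these properties, and the properties are stable
under composition and monoidal product; the point is that two affine functionals in disjoint sets
of variables add up to an affine functional (`row_append`). A copyable morphism `m → n + 1` is the
pairing of its projections to the first `n` wires and to the last wire, and the latter projection
is itself an affine functional. By induction on `n`, a deterministic morphism is determined by the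
affine map which it denotes (`IsDet.eq_of_sem_eq`), and every affine map is so denoted
(`exists_isDet`).

Next, every morphism `m → n` has a dilation: it arises from a deterministic morphism
`L : m + k → n` by feeding `k` independent standard normal variables into the last `k` inputs
(`exists_dilation`). Here `k` may be enlarged, since noise can be discarded. If `L` denotes the
affine map with linear part `[A | N]` and constant part `b`, then the dilation denotes
`(A, b, N Nᵀ)`. This gives fullness, since every positive semidefinite matrix is of the form
`N Nᵀ`.

If two dilations with the same `k` denote the same Gaussian map, then `N Nᵀ = N' N'ᵀ`, so
`N' = N U` for an orthogonal matrix `U` (`exists_orthogonal_of_mul_transpose_eq`). It remains to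
absorb `U` into the noise (`fixesNoise_of_orthogonal`). Rotations of coordinate planes can be
absorbed by the axiom on rotations, and so can the sign change of one variable, which is half of a
rotation by `π`. Together these act transitively on unit vectors, and an orthogonal matrix that
fixes the last unit vector is block diagonal, so that induction on the size applies.

Transport along equalities of natural numbers is avoided by computing with `PropCat.Arrow`, the
type of all morphisms of a prop, on which the monoidal product is strictly associative.
-/

/-! ### Arrows of a prop -/

/-- A morphism of a prop bundled with its domain and codomain. In this form the monoidal product
is associative and unital on the nose, and transport along equalities of objects disappears. -/
structure PropCat.Arrow (C : PropCat) where
  dom : ℕ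
  cod : ℕ
  hom : C.Hom dom cod

namespace PropCat.Arrow

variable {C : PropCat}

/-- Composition of arrows, written `f ⨟ g`. When the middle objects differ, the junk value is the first arrow. -/
def seq (f g : C.Arrow) : C.Arrow :=
  if h : f.cod = g.dom then ⟨f.dom, g.cod, C.comp f.hom (castHom h.symm rfl g.hom)⟩ else f

/-- Monoidal product of arrows, written `f ⊠ g`. -/
def par (f g : C.Arrow) : C.Arrow := ⟨f.dom + g.dom, f.cod + g.cod, C.tensor f.hom g.hom⟩

/-- Identity arrows. -/
def idn (C : PropCat) (n : ℕ) : C.Arrow := ⟨n, n, C.id n⟩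

/-- Symmetries as arrows. -/
def sw (C : PropCat) (m n : ℕ) : C.Arrow := ⟨m + n, n + m, C.symm m n⟩

infixl:65 " ⨟ " => PropCat.Arrow.seq
infixl:75 " ⊠ " => PropCat.Arrow.par

theorem mk_castHom {m n m' n' : ℕ} (hm : m = m') (hn : n = n') (f : C.Hom m n) :
    (⟨m', n', castHom hm hn f⟩ : C.Arrow) = ⟨m, n, f⟩ := by subst hm hn; rfl

theorem mk_inj {m n : ℕ} {f g : C.Hom m n} (h : (⟨m, n, f⟩ : C.Arrow) = ⟨m, n, g⟩) : f = g := by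
  simpa using h

theorem mk_comp {m n k : ℕ} (f : C.Hom m n) (g : C.Hom n k) :
    (⟨m, k, C.comp f g⟩ : C.Arrow) = ⟨m, n, f⟩ ⨟ ⟨n, k, g⟩ := by
  simp only [seq, dite_true, castHom]

theorem mk_tensor {m n m' n' : ℕ} (f : C.Hom m n) (g : C.Hom m' n') :
    (⟨m + m', n + n', C.tensor f g⟩ : C.Arrow) = ⟨m, n, f⟩ ⊠ ⟨m', n', g⟩ := rfl

theorem mk_id (n : ℕ) : (⟨n, n, C.id n⟩ : C.Arrow) = idn C n := rfl

theorem mk_symm (m n : ℕ) : (⟨m + n, n + m, C.symm m n⟩ : C.Arrow) = sw C m n := rfl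

@[simp] theorem idn_dom (n : ℕ) : (idn C n).dom = n := (rfl)
@[simp] theorem idn_cod (n : ℕ) : (idn C n).cod = n := (rfl)
@[simp] theorem sw_dom (m n : ℕ) : (sw C m n).dom = m + n := (rfl)
@[simp] theorem sw_cod (m n : ℕ) : (sw C m n).cod = n + m := (rfl)
@[simp] theorem par_dom (f g : C.Arrow) : (f ⊠ g).dom = f.dom + g.dom := (rfl)
@[simp] theorem par_cod (f g : C.Arrow) : (f ⊠ g).cod = f.cod + g.cod := (rfl)

@[simp] theorem seq_dom (f g : C.Arrow) : (f ⨟ g).dom = f.dom := by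
  unfold seq; split_ifs <;> rfl

@[simp] theorem seq_cod {f g : C.Arrow} (h : f.cod = g.dom) : (f ⨟ g).cod = g.cod := by
  unfold seq; rw [dif_pos h]

theorem assoc_seq {f g h : C.Arrow} (hfg : f.cod = g.dom) (hgh : g.cod = h.dom) :
    f ⨟ g ⨟ h = f ⨟ (g ⨟ h) := by
  obtain ⟨a, b, f⟩ := f
  obtain ⟨b', c, g⟩ := g
  obtain ⟨c', d, h⟩ := h
  cases hfg; cases hgh
  simp only [← mk_comp, C.comp_assoc]

@[simp] theorem idn_seq {f : C.Arrow} {n : ℕ} (h : n = f.dom) : idn C n ⨟ f = f := by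
  obtain ⟨a, b, f⟩ := f
  cases h
  simp only [← mk_comp, ← mk_id, C.id_comp]

@[simp] theorem seq_idn {f : C.Arrow} {n : ℕ} (h : f.cod = n) : f ⨟ idn C n = f := by
  obtain ⟨a, b, f⟩ := f
  cases h
  simp only [← mk_comp, ← mk_id, C.comp_id]

theorem par_assoc (f g h : C.Arrow) : f ⊠ g ⊠ h = f ⊠ (g ⊠ h) := by
  obtain ⟨a, b, f⟩ := f
  obtain ⟨b', c, g⟩ := g
  obtain ⟨c', d, h⟩ := h
  simp only [← mk_tensor, C.tensor_assoc, mk_castHom]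

@[simp] theorem idn_zero_par (f : C.Arrow) : idn C 0 ⊠ f = f := by
  obtain ⟨a, b, f⟩ := f
  simp only [← mk_tensor, ← mk_id, C.id_tensor, mk_castHom]

@[simp] theorem par_idn_zero (f : C.Arrow) : f ⊠ idn C 0 = f := by
  obtain ⟨a, b, f⟩ := f
  simp only [← mk_tensor, ← mk_id, C.tensor_id, mk_castHom]

theorem idn_add (m n : ℕ) : idn C (m + n) = idn C m ⊠ idn C n := by
  simp only [← mk_tensor, ← mk_id, C.id_tensor_id]

theorem par_seq_par {f g f' g' : C.Arrow} (h : f.cod = g.dom) (h' : f'.cod = g'.dom) :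
    (f ⊠ f') ⨟ (g ⊠ g') = (f ⨟ g) ⊠ (f' ⨟ g') := by
  obtain ⟨a, b, f⟩ := f
  obtain ⟨b', c, g⟩ := g
  obtain ⟨_, _, f'⟩ := f'
  obtain ⟨_, _, g'⟩ := g'
  cases h; cases h'
  simp only [← mk_comp, ← mk_tensor, C.interchange]

theorem sw_natural {f g : C.Arrow} {a b a' b' : ℕ} (h : f.cod = a) (h' : g.cod = b)
    (k : f.dom = a') (k' : g.dom = b') :
    f ⊠ g ⨟ sw C a b = sw C a' b' ⨟ (g ⊠ f) := by
  subst h h' k k'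
  simp only [← mk_comp, par, sw, C.symm_natural]

@[simp] theorem sw_sw (m n : ℕ) : sw C m n ⨟ sw C n m = idn C (m + n) := by
  simp only [← mk_comp, sw, C.symm_symm, mk_id]

theorem sw_add_right (m n k : ℕ) :
    sw C m (n + k) = (sw C m n ⊠ idn C k) ⨟ (idn C n ⊠ sw C m k) := by
  have h := congrArg (fun x => (⟨_, _, x⟩ : C.Arrow)) (C.hexagon m n k)
  simp only [mk_castHom, mk_comp, mk_tensor, mk_id, mk_symm] at h
  exact h

/-- Uniqueness of the inverse of a symmetry. -/
theorem eq_sw {f : C.Arrow} {m n : ℕ} (hf : f.dom = m + n)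
    (h : sw C n m ⨟ f = idn C (n + m)) : f = sw C m n := by
  have h2 := congrArg (sw C m n ⨟ ·) h
  beta_reduce at h2
  rwa [← assoc_seq (by simp) (by simp [hf]), sw_sw, idn_seq hf.symm, seq_idn (by simp)] at h2

/-- The hexagon law in the first argument, by inverting the hexagon law in the second. -/
theorem sw_add_left (m n k : ℕ) :
    sw C (m + n) k = (idn C m ⊠ sw C n k) ⨟ (sw C m k ⊠ idn C n) := by
  symm
  apply eq_sw (by simp +arith)
  rw [sw_add_right, assoc_seq (by simp +arith) (by simp +arith),
    ← assoc_seq (f := idn C m ⊠ _) (by simp) (by simp +arith),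
    par_seq_par (by simp) (by simp), sw_sw]
  rw [idn_seq (by simp), ← idn_add, idn_seq (by simp +arith), par_seq_par (by simp) (by simp),
    sw_sw, idn_seq (by simp), ← idn_add, add_assoc]

/-- By the hexagon law `sw m 0` is idempotent, and it is invertible. -/
@[simp] theorem sw_zero_right (m : ℕ) : sw C m 0 = idn C m := by
  have h : sw C m 0 = sw C m 0 ⨟ sw C m 0 := by
    have := sw_add_right (C := C) m 0 0
    rwa [par_idn_zero, idn_zero_par] at this
  have h2 := congrArg (sw C 0 m ⨟ ·) h
  beta_reduce at h2
  rw [← assoc_seq (by simp) (by simp), sw_sw, idn_seq (by simp)] at h2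
  rw [← h2, zero_add]

@[simp] theorem sw_zero_left (m : ℕ) : sw C 0 m = idn C m := by
  have h := sw_sw (C := C) 0 m
  rwa [sw_zero_right, seq_idn (by simp), zero_add] at h

theorem idn_par_seq {f g : C.Arrow} (n : ℕ) (h : f.cod = g.dom) :
    idn C n ⊠ (f ⨟ g) = (idn C n ⊠ f) ⨟ (idn C n ⊠ g) := by
  rw [par_seq_par (by simp) h, idn_seq (by simp)]

theorem seq_par_idn {f g : C.Arrow} (n : ℕ) (h : f.cod = g.dom) :
    (f ⨟ g) ⊠ idn C n = (f ⊠ idn C n) ⨟ (g ⊠ idn C n) := by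
  rw [par_seq_par h (by simp), idn_seq (by simp)]

theorem seq_par {f g : C.Arrow} (k : C.Arrow) (h : f.cod = g.dom) :
    (f ⨟ g) ⊠ k = f ⊠ k ⨟ g ⊠ idn C k.cod := by
  rw [par_seq_par h (by simp), seq_idn rfl]

theorem par_seq {f g : C.Arrow} (k : C.Arrow) (h : f.cod = g.dom) :
    k ⊠ (f ⨟ g) = k ⊠ f ⨟ idn C k.cod ⊠ g := by
  rw [par_seq_par (by simp) h, seq_idn rfl]

/-- The two orders of moving a pair of blocks past each other and past a third block agree. -/
theorem sw_sw_exchange (m n k : ℕ) :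
    (sw C m n ⊠ idn C (n + k)) ⨟ (idn C n ⊠ sw C (m + n) k) =
      (idn C (m + n) ⊠ sw C n k) ⨟ (sw C m (n + k) ⊠ idn C n) := by
  have e : (sw C m n ⊠ idn C (n + k)) ⨟ (idn C (n + m) ⊠ sw C n k) =
      (idn C (m + n) ⊠ sw C n k) ⨟ (sw C m n ⊠ idn C (k + n)) := by
    rw [par_seq_par (by simp) (by simp), par_seq_par (by simp) (by simp)]
    simp
  rw [sw_add_left, sw_add_right, idn_par_seq _ (by simp +arith), seq_par_idn _ (by simp +arith),
    ← par_assoc, ← idn_add, ← assoc_seq (by simp +arith) (by simp +arith), e,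
    assoc_seq (by simp +arith) (by simp +arith), idn_add k n, ← par_assoc, ← par_assoc]

end PropCat.Arrow

/-! ### Generators and axioms as arrows -/

namespace CausalGQA

open PropCat.Arrow

/-- The prop of causal graphical quadratic algebra. -/
abbrev gqa : PropCat := causalGQA.freeProp

/-- The morphism presented by a term. -/
def cls {m n : ℕ} (c : Tm m n) : gqa.Hom m n := SMT.FreeHom.mk causalGQA c

/-- The arrow presented by a term. -/
def arr {m n : ℕ} (c : Tm m n) : gqa.Arrow := ⟨m, n, cls c⟩

local notation "I" => PropCat.Arrow.idn gqa
local notation "S" => PropCat.Arrow.sw gqa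

@[simp] theorem arr_dom {m n : ℕ} (c : Tm m n) : (arr c).dom = m := (rfl)
@[simp] theorem arr_cod {m n : ℕ} (c : Tm m n) : (arr c).cod = n := (rfl)

theorem arr_seq {m n k : ℕ} (c : Tm m n) (d : Tm n k) : arr (c ⨾ d) = arr c ⨟ arr d :=
  mk_comp (C := gqa) (cls c) (cls d)

theorem arr_eq {m n : ℕ} {c d : Tm m n} (h : Ax c d) : arr c = arr d :=
  congrArg (fun f => (⟨m, n, f⟩ : gqa.Arrow)) (SMT.FreeHom.sound (T := causalGQA) (.eqn h))

/-- The arrow `copy`. -/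
def cp : gqa.Arrow := arr copy
/-- The arrow `del`. -/
def dc : gqa.Arrow := arr discard
/-- The arrow `add`. -/
def ad : gqa.Arrow := arr add
/-- The arrow `zero`. -/
def zr : gqa.Arrow := arr zero
/-- The arrow of a scalar. -/
def sc (k : ℝ) : gqa.Arrow := arr (scalar k)
/-- The arrow `one`. -/
def on : gqa.Arrow := arr one
/-- The arrow `normal`. -/
def nm : gqa.Arrow := arr normal

@[simp] theorem cp_dom : cp.dom = 1 := (rfl)
@[simp] theorem cp_cod : cp.cod = 2 := (rfl)
@[simp] theorem dc_dom : dc.dom = 1 := (rfl)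
@[simp] theorem dc_cod : dc.cod = 0 := (rfl)
@[simp] theorem ad_dom : ad.dom = 2 := (rfl)
@[simp] theorem ad_cod : ad.cod = 1 := (rfl)
@[simp] theorem zr_dom : zr.dom = 0 := (rfl)
@[simp] theorem zr_cod : zr.cod = 1 := (rfl)
@[simp] theorem sc_dom (k : ℝ) : (sc k).dom = 1 := (rfl)
@[simp] theorem sc_cod (k : ℝ) : (sc k).cod = 1 := (rfl)
@[simp] theorem on_dom : on.dom = 0 := (rfl)
@[simp] theorem on_cod : on.cod = 1 := (rfl)
@[simp] theorem nm_dom : nm.dom = 0 := (rfl)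
@[simp] theorem nm_cod : nm.cod = 1 := (rfl)

theorem ad_assoc : ad ⊠ I 1 ⨟ ad = I 1 ⊠ ad ⨟ ad := by
  have h := arr_eq .add_assoc
  rw [arr_seq, arr_seq] at h
  exact h

theorem ad_comm : S 1 1 ⨟ ad = ad := by
  have h := arr_eq .add_comm
  rw [arr_seq] at h
  exact h

theorem zr_ad : zr ⊠ I 1 ⨟ ad = I 1 := by
  have h := arr_eq .add_unit
  rw [arr_seq] at h
  exact h

theorem cp_assoc : cp ⨟ cp ⊠ I 1 = cp ⨟ I 1 ⊠ cp := by
  have h := arr_eq .copy_coassoc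
  rw [arr_seq, arr_seq] at h
  exact h

theorem cp_comm : cp ⨟ S 1 1 = cp := by
  have h := arr_eq .copy_cocomm
  rw [arr_seq] at h
  exact h

theorem cp_dc_left : cp ⨟ dc ⊠ I 1 = I 1 := by
  have h := arr_eq .copy_counit
  rw [arr_seq] at h
  exact h

theorem on_cp : on ⨟ cp = on ⊠ on := by
  have h := arr_eq .one_dup
  rw [arr_seq] at h
  exact h

theorem on_dc : on ⨟ dc = I 0 := by
  have h := arr_eq .one_del
  rw [arr_seq] at h
  exact h

theorem ad_sc (k : ℝ) : ad ⨟ sc k = sc k ⊠ sc k ⨟ ad := by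
  have h := arr_eq (.scalar_add k)
  rw [arr_seq, arr_seq] at h
  exact h

theorem zr_sc (k : ℝ) : zr ⨟ sc k = zr := by
  have h := arr_eq (.scalar_zero k)
  rw [arr_seq] at h
  exact h

theorem sc_cp (k : ℝ) : sc k ⨟ cp = cp ⨟ sc k ⊠ sc k := by
  have h := arr_eq (.scalar_dup k)
  rw [arr_seq, arr_seq] at h
  exact h

theorem sc_dc (k : ℝ) : sc k ⨟ dc = dc := by
  have h := arr_eq (.scalar_del k)
  rw [arr_seq] at h
  exact h

theorem sc_sc (k l : ℝ) : sc k ⨟ sc l = sc (k * l) := by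
  have h := arr_eq (.mult k l)
  rw [arr_seq] at h
  exact h

theorem cp_sc_ad (k l : ℝ) : cp ⨟ sc k ⊠ sc l ⨟ ad = sc (k + l) := by
  have h := arr_eq (.plus k l)
  rw [arr_seq, arr_seq] at h
  exact h

theorem sc_zero : sc 0 = dc ⨟ zr := by
  have h := arr_eq .zero_scalar
  rw [arr_seq] at h
  exact h

theorem sc_one : sc 1 = I 1 := arr_eq .one_scalar

theorem ad_cp : ad ⨟ cp = cp ⊠ cp ⨟ (I 1 ⊠ S 1 1 ⊠ I 1) ⨟ ad ⊠ ad := by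
  have h := arr_eq .bimonoid
  rw [arr_seq, arr_seq, arr_seq] at h
  exact h

theorem zr_cp : zr ⨟ cp = zr ⊠ zr := by
  have h := arr_eq .zero_dup
  rw [arr_seq] at h
  exact h

theorem zr_dc : zr ⨟ dc = I 0 := by
  have h := arr_eq .zero_del
  rw [arr_seq] at h
  exact h

theorem ad_dc : ad ⨟ dc = dc ⊠ dc := by
  have h := arr_eq .add_del
  rw [arr_seq] at h
  exact h

theorem nm_dc : nm ⨟ dc = I 0 := by
  have h := arr_eq .normal_del
  rw [arr_seq] at h
  exact h

theorem cp_dc_right : cp ⨟ I 1 ⊠ dc = I 1 := by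
  rw [← cp_comm, assoc_seq (by simp) (by simp),
    ← sw_natural (a' := 1) (b' := 1) (a := 0) (b := 1) (f := dc) (g := I 1) rfl rfl rfl rfl,
    sw_zero_left, seq_idn (by simp), cp_dc_left]

/-! ### Copying and discarding blocks of wires -/

/-- The morphism copying `n` wires. -/
def dupHom : ∀ n : ℕ, gqa.Hom n (n + n)
  | 0 => gqa.id 0
  | n + 1 => gqa.comp (gqa.tensor (dupHom n) (cls copy))
      (castHom (by omega) (by omega)
        (gqa.tensor (gqa.tensor (gqa.id n) (gqa.symm n 1)) (gqa.id 1)))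

/-- The morphism discarding `n` wires. -/
def delHom : ∀ n : ℕ, gqa.Hom n 0
  | 0 => gqa.id 0
  | n + 1 => gqa.tensor (delHom n) (cls discard)

/-- The arrow copying `n` wires. -/
def dup (n : ℕ) : gqa.Arrow := ⟨n, n + n, dupHom n⟩

/-- The arrow discarding `n` wires. -/
def del (n : ℕ) : gqa.Arrow := ⟨n, 0, delHom n⟩

@[simp] theorem dup_dom (n : ℕ) : (dup n).dom = n := (rfl)
@[simp] theorem dup_cod (n : ℕ) : (dup n).cod = n + n := (rfl)
@[simp] theorem del_dom (n : ℕ) : (del n).dom = n := (rfl)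
@[simp] theorem del_cod (n : ℕ) : (del n).cod = 0 := (rfl)

@[simp] theorem dup_zero : dup 0 = I 0 := rfl
@[simp] theorem del_zero : del 0 = I 0 := rfl

theorem dup_succ (n : ℕ) : dup (n + 1) = dup n ⊠ cp ⨟ I n ⊠ S n 1 ⊠ I 1 := by
  rw [dup, dupHom, mk_comp, mk_castHom]
  rfl

theorem del_succ (n : ℕ) : del (n + 1) = del n ⊠ dc := rfl

@[simp] theorem dup_one : dup 1 = cp := by
  have h := dup_succ 0
  rw [dup_zero, idn_zero_par, idn_zero_par, sw_zero_left, ← idn_add, seq_idn (by simp)] at h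
  exact h

@[simp] theorem del_one : del 1 = dc := by
  have h := del_succ 0
  rwa [del_zero, idn_zero_par] at h

theorem del_add (m n : ℕ) : del (m + n) = del m ⊠ del n := by
  induction n with
  | zero => simp
  | succ n ih => rw [← add_assoc, del_succ, ih, del_succ, par_assoc]

/-- Copying is compatible with the monoidal product, up to interchanging the middle blocks. -/
theorem dup_add (m n : ℕ) : dup (m + n) = dup m ⊠ dup n ⨟ I m ⊠ S m n ⊠ I n := by
  induction n with
  | zero =>
    rw [dup_zero, sw_zero_right, par_idn_zero, par_idn_zero, ← idn_add, seq_idn (by simp +arith)]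
    rfl
  | succ n ih =>
    have key : I m ⊠ S m n ⊠ I n ⊠ I 2 ⨟ I (m + n) ⊠ S (m + n) 1 ⊠ I 1 =
        I (m + m) ⊠ (I n ⊠ S n 1 ⊠ I 1) ⨟ I m ⊠ S m (n + 1) ⊠ I (n + 1) := by
      have h := congrArg (fun x => I m ⊠ x ⊠ I 1) (sw_sw_exchange (C := gqa) m n 1)
      beta_reduce at h
      rw [idn_par_seq _ (by simp +arith), idn_par_seq _ (by simp +arith),
        seq_par_idn _ (by simp +arith), seq_par_idn _ (by simp +arith)] at h
      convert h using 2 <;> simp only [idn_add, par_assoc, show (2 : ℕ) = 1 + 1 from rfl]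
    rw [← add_assoc, dup_succ, ih, dup_succ, seq_par _ (by simp +arith),
      par_seq _ (by simp +arith), cp_cod, dup_cod, assoc_seq (by simp +arith) (by simp +arith),
      key, ← assoc_seq (by simp +arith) (by simp +arith), par_assoc]

theorem dup_del_right (n : ℕ) : dup n ⨟ I n ⊠ del n = I n := by
  induction n with
  | zero => simp
  | succ n ih =>
    have e : I n ⊠ S n 1 ⊠ I 1 ⨟ I (n + 1) ⊠ del (n + 1) = I n ⊠ del n ⊠ (I 1 ⊠ dc) := by
      have h := sw_natural (C := gqa) (f := del n) (g := I 1) (a := 0) (b := 1) (a' := n) (b' := 1) rfl rfl rfl rfl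
      rw [sw_zero_left, seq_idn (by simp +arith)] at h
      rw [idn_add n 1, del_succ, ← par_assoc, par_seq_par (by simp +arith) (by simp +arith), par_assoc (I n),
        par_seq_par (by simp +arith) (by simp +arith), ← h]
      simp [par_assoc]
    rw [dup_succ, assoc_seq (by simp +arith) (by simp +arith), e, par_seq_par (by simp +arith) (by simp +arith),
      ih, cp_dc_right, ← idn_add]

/-- Copying `n + 1` wires, and keeping the first `n` wires of the first copy and the last wire of the
second, is the identity. -/
theorem dup_succ_proj (n : ℕ) :
    dup (n + 1) ⨟ (I n ⊠ dc) ⊠ (del n ⊠ I 1) = I (n + 1) := by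
  have e : I n ⊠ S n 1 ⊠ I 1 ⨟ (I n ⊠ dc) ⊠ (del n ⊠ I 1) = I n ⊠ del n ⊠ (dc ⊠ I 1) := by
    have h := sw_natural (C := gqa) (f := del n) (g := dc) (a := 0) (b := 0) (a' := n) (b' := 1) rfl rfl rfl rfl
    rw [sw_zero_left, seq_idn (by simp +arith)] at h
    rw [← par_assoc, par_seq_par (by simp +arith) (by simp +arith), par_assoc (I n), par_seq_par (by simp +arith)
      (by simp +arith), ← h]
    simp [par_assoc]
  rw [dup_succ, assoc_seq (by simp +arith) (by simp +arith), e, par_seq_par (by simp +arith) (by simp +arith),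
    dup_del_right, cp_dc_left, ← idn_add]

/-! ### Copyable arrows -/

/-- An arrow is copyable if it is a homomorphism for copying and discarding. -/
structure Copyable (f : gqa.Arrow) : Prop where
  dup : f ⨟ dup f.cod = dup f.dom ⨟ f ⊠ f
  del : f ⨟ del f.cod = del f.dom

theorem Copyable.seq {f g : gqa.Arrow} (hf : Copyable f) (hg : Copyable g) (h : f.cod = g.dom) :
    Copyable (f ⨟ g) := by
  constructor
  · rw [seq_cod h, seq_dom, assoc_seq h (by simp +arith), hg.dup, ← assoc_seq (by simp [h]) (by simp +arith),
      ← h, hf.dup, assoc_seq (by simp +arith) (by simp [h]), par_seq_par h h]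
  · rw [seq_cod h, seq_dom, assoc_seq h (by simp +arith), hg.del, ← h, hf.del]

theorem Copyable.idn (n : ℕ) : Copyable (I n) := by
  constructor
  · simp [← idn_add]
  · simp

theorem Copyable.par {f g : gqa.Arrow} (hf : Copyable f) (hg : Copyable g) :
    Copyable (f ⊠ g) := by
  constructor
  · have h := sw_natural (C := gqa) (f := f) (g := g) rfl rfl rfl rfl
    rw [par_cod, dup_add, ← assoc_seq (by simp +arith) (by simp +arith), par_seq_par (by simp +arith) (by simp +arith),
      hf.dup, hg.dup, ← par_seq_par (by simp +arith) (by simp +arith), par_dom, dup_add,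
      assoc_seq (by simp +arith) (by simp +arith), assoc_seq (by simp +arith) (by simp +arith)]
    congr 1
    have e1 : f ⊠ f ⊠ (g ⊠ g) = f ⊠ (f ⊠ g ⊠ g) := by simp only [par_assoc]
    have e2 : f ⊠ g ⊠ (f ⊠ g) = f ⊠ (g ⊠ f ⊠ g) := by simp only [par_assoc]
    rw [e1, e2, par_assoc (I _), par_assoc (I _), par_seq_par (by simp) (by simp +arith),
      par_seq_par (by simp) (by simp), h, par_seq_par (by simp) (by simp +arith),
      par_seq_par (by simp) (by simp)]
    simp
  · rw [par_cod, del_add, par_seq_par (by simp +arith) (by simp +arith), hf.del, hg.del, par_dom, del_add]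

theorem Copyable.sw (m n : ℕ) : Copyable (S m n) := by
  constructor
  · have e : S (m + m) (n + n) ⨟ I n ⊠ S n m ⊠ I m = I m ⊠ S m n ⊠ I n ⨟ S m n ⊠ S m n := by
      rw [sw_add_left, sw_add_right, idn_par_seq _ (by simp +arith),
        seq_par_idn _ (by simp +arith)]
      have e1 : S m n ⊠ I n ⊠ I m = S m n ⊠ I (n + m) := by rw [par_assoc, ← idn_add]
      have e2 : I m ⊠ (I n ⊠ S m n) = I (m + n) ⊠ S m n := by rw [← par_assoc, ← idn_add]
      have e3 : I n ⊠ S m n ⊠ I m ⨟ I n ⊠ S n m ⊠ I m = I (n + (m + n) + m) := by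
        rw [← seq_par_idn _ (by simp), ← idn_par_seq _ (by simp), sw_sw, ← idn_add, ← idn_add]
      have e4 : S m n ⊠ S m n = I (m + n) ⊠ S m n ⨟ S m n ⊠ I (n + m) := by
        rw [par_seq_par (by simp) (by simp), idn_seq (by simp), seq_idn (by simp)]
      rw [e1, e2, e4, assoc_seq (by simp +arith) (by simp +arith),
        assoc_seq (by simp +arith) (by simp +arith), assoc_seq (by simp +arith) (by simp +arith),
        e3, seq_idn (by simp +arith), par_assoc]
    rw [sw_cod, sw_dom, dup_add, dup_add, assoc_seq (by simp +arith) (by simp +arith), ← e,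
      ← assoc_seq (by simp +arith) (by simp +arith), ← assoc_seq (by simp +arith) (by simp +arith),
      sw_natural (a' := m) (b' := n) (by simp +arith) (by simp +arith) (by simp +arith) (by simp +arith)]
  · rw [sw_cod, sw_dom, del_add, del_add, ← sw_natural (C := gqa) (f := CausalGQA.del m) (g := CausalGQA.del n) (a := 0) (b := 0)
      (a' := m) (b' := n) rfl rfl rfl rfl]
    simp

theorem Copyable.cp : Copyable cp := by
  constructor
  · have e : CausalGQA.cp ⨟ CausalGQA.cp ⊠ CausalGQA.cp ⨟ I 1 ⊠ S 1 1 ⊠ I 1 =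
        CausalGQA.cp ⨟ CausalGQA.cp ⊠ CausalGQA.cp := by
      have h1 : CausalGQA.cp ⨟ CausalGQA.cp ⊠ CausalGQA.cp =
          CausalGQA.cp ⨟ CausalGQA.cp ⊠ I 1 ⨟ (I 1 ⊠ CausalGQA.cp) ⊠ I 1 := by
        have h2 : CausalGQA.cp ⊠ CausalGQA.cp =
            CausalGQA.cp ⊠ I 1 ⨟ I 1 ⊠ (I 1 ⊠ CausalGQA.cp) := by
          rw [← par_assoc, ← idn_add, par_seq_par (by simp +arith) (by simp +arith)]
          simp
        rw [h2, ← assoc_seq (by simp +arith) (by simp +arith), cp_assoc, assoc_seq (by simp +arith) (by simp +arith),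
          par_seq_par (by simp +arith) (by simp +arith), ← cp_assoc, ← par_seq_par (by simp +arith) (by simp +arith),
          ← assoc_seq (by simp +arith) (by simp +arith), ← cp_assoc, par_assoc]
      rw [h1, assoc_seq (by simp +arith) (by simp +arith), par_seq_par (by simp +arith) (by simp +arith),
        par_seq_par (by simp +arith) (by simp +arith), cp_comm]
      simp
    rw [cp_cod, cp_dom, show (2 : ℕ) = 1 + 1 from rfl, dup_add, dup_one,
      ← assoc_seq (by simp +arith) (by simp +arith), e]
  · rw [cp_cod, cp_dom, show (2 : ℕ) = 1 + 1 from rfl, del_add, del_one,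
      show dc ⊠ dc = (dc ⊠ I 1) ⨟ dc by
        conv_rhs => rw [← idn_zero_par dc, par_seq_par (by simp +arith) (by simp +arith)]
        simp, ← assoc_seq (by simp +arith) (by simp +arith), cp_dc_left]
    simp

theorem Copyable.dc : Copyable dc := by
  constructor
  · have e : CausalGQA.dc ⊠ CausalGQA.dc = CausalGQA.dc ⊠ I 1 ⨟ CausalGQA.dc := by
      have h := par_seq_par (C := gqa) (f := CausalGQA.dc) (g := I 0) (f' := I 1)
        (g' := CausalGQA.dc) rfl rfl
      rw [idn_zero_par] at h
      rw [h, seq_idn (by simp), idn_seq (by simp)]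
    rw [dc_cod, dc_dom, dup_zero, dup_one, e, ← assoc_seq rfl rfl, cp_dc_left, idn_seq (by simp),
      seq_idn (by simp)]
  · rw [dc_cod, dc_dom, del_zero, del_one, seq_idn (by simp)]

theorem Copyable.ad : Copyable ad := by
  constructor
  · rw [ad_cod, ad_dom, dup_one, ad_cp, show (2 : ℕ) = 1 + 1 from rfl, dup_add, dup_one]
  · rw [ad_cod, ad_dom, del_one, ad_dc, show (2 : ℕ) = 1 + 1 from rfl, del_add, del_one]

theorem Copyable.zr : Copyable zr := by
  constructor
  · rw [zr_cod, zr_dom, dup_one, zr_cp, dup_zero, idn_seq (by simp)]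
  · rw [zr_cod, zr_dom, del_one, zr_dc, del_zero]

theorem Copyable.on : Copyable on := by
  constructor
  · rw [on_cod, on_dom, dup_one, on_cp, dup_zero, idn_seq (by simp)]
  · rw [on_cod, on_dom, del_one, on_dc, del_zero]

theorem Copyable.sc (k : ℝ) : Copyable (sc k) := by
  constructor
  · rw [sc_cod, sc_dom, dup_one, sc_cp]
  · rw [sc_cod, sc_dom, del_one, sc_dc]

/-- A copyable arrow is the pairing of its projections. -/
theorem Copyable.eq_pair {f : gqa.Arrow} (hf : Copyable f) {n : ℕ} (h : f.cod = n + 1) :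
    f = CausalGQA.dup f.dom ⨟ (f ⨟ I n ⊠ CausalGQA.dc) ⊠ (f ⨟ CausalGQA.del n ⊠ I 1) := by
  rw [← par_seq_par (by simp [h]) (by simp [h]), ← assoc_seq (by simp) (by simp [h]), ← hf.dup, h,
    assoc_seq (by simp [h]) (by simp +arith), dup_succ_proj, seq_idn h]

/-! ### Affine functionals -/

/-- The affine functional `x ↦ β + ∑ i, s i * x i`, as a morphism `n → 1`. -/
def rowHom (β : ℝ) : ∀ n : ℕ, (Fin n → ℝ) → gqa.Hom n 1
  | 0, _ => gqa.comp (cls one) (cls (scalar β))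
  | n + 1, s => gqa.comp (gqa.tensor (rowHom β n (Fin.init s)) (cls (scalar (s (Fin.last n)))))
      (cls add)

/-- The affine functional `x ↦ β + ∑ i, s i * x i`, as an arrow. -/
def row (β : ℝ) {n : ℕ} (s : Fin n → ℝ) : gqa.Arrow := ⟨n, 1, rowHom β n s⟩

@[simp] theorem row_dom (β : ℝ) {n : ℕ} (s : Fin n → ℝ) : (row β s).dom = n := (rfl)
@[simp] theorem row_cod (β : ℝ) {n : ℕ} (s : Fin n → ℝ) : (row β s).cod = 1 := (rfl)

theorem row_zero (β : ℝ) (s : Fin 0 → ℝ) : row β s = on ⨟ sc β := by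
  rw [row, rowHom, mk_comp]
  rfl

theorem row_succ (β : ℝ) {n : ℕ} (s : Fin (n + 1) → ℝ) :
    row β s = row β (Fin.init s) ⊠ sc (s (Fin.last n)) ⨟ ad := by
  rw [row, rowHom, mk_comp, mk_tensor]
  rfl

theorem ad_zr : I 1 ⊠ zr ⨟ ad = I 1 := by
  have h := sw_natural (C := gqa) (f := I 1) (g := zr) (a := 1) (b := 1) (a' := 1) (b' := 0)
    rfl rfl rfl rfl
  rw [sw_zero_right, idn_seq (by simp)] at h
  rw [← ad_comm, ← assoc_seq rfl rfl, h, zr_ad]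

theorem par_ad_assoc {f g h : gqa.Arrow} (hf : f.cod = 1) (hg : g.cod = 1) (hh : h.cod = 1) :
    (f ⊠ g ⨟ ad) ⊠ h ⨟ ad = f ⊠ (g ⊠ h ⨟ ad) ⨟ ad := by
  rw [seq_par _ (by simp [hf, hg]), par_seq _ (by simp [hg, hh]), hf, hh,
    assoc_seq (by simp [hf, hg, hh]) (by simp), ad_assoc,
    assoc_seq (by simp [hf, hg, hh]) (by simp), par_assoc]

theorem par_ad_comm {f g : gqa.Arrow} (hf : f.cod = 1) (hg : g.cod = 1) :
    f ⊠ g ⨟ ad = S f.dom g.dom ⨟ (g ⊠ f ⨟ ad) := by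
  have h := sw_natural (C := gqa) (f := f) (g := g) (a := 1) (b := 1) hf hg rfl rfl
  rw [← assoc_seq (by simp) (by simp [hf, hg]), ← h, assoc_seq (by simp [hf, hg]) (by simp),
    ad_comm]

theorem par_ad_right_comm {f g h : gqa.Arrow} (hf : f.cod = 1) (hg : g.cod = 1) (hh : h.cod = 1)
    (hh0 : h.dom = 0) : (f ⊠ g ⨟ ad) ⊠ h ⨟ ad = (f ⊠ h ⨟ ad) ⊠ g ⨟ ad := by
  rw [par_ad_assoc hf hg hh, par_ad_assoc hf hh hg, par_ad_comm hg hh, hh0, sw_zero_right,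
    idn_seq (by simp [hh0])]

/-- A constant is absorbed into an affine functional. -/
theorem row_par_const (β γ : ℝ) {n : ℕ} (s : Fin n → ℝ) :
    row β s ⊠ (on ⨟ sc γ) ⨟ ad = row (β + γ) s := by
  induction n with
  | zero =>
    rw [row_zero, row_zero, ← par_seq_par (by simp) (by simp), ← on_cp,
      assoc_seq (by simp) (by simp), assoc_seq (by simp) (by simp), ← cp_sc_ad,
      assoc_seq (by simp) (by simp)]
  | succ n ih =>
    rw [row_succ, par_ad_right_comm (by simp) (by simp) (by simp) (by simp), ih, row_succ]

/-- The sum of affine functionals in disjoint sets of variables. -/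
theorem row_append (β γ : ℝ) {m n : ℕ} (s : Fin m → ℝ) (t : Fin n → ℝ) :
    row β s ⊠ row γ t ⨟ ad = row (β + γ) (Fin.append s t) := by
  induction n with
  | zero =>
    rw [row_zero, row_par_const, Fin.append_right_nil s t rfl]
    rfl
  | succ n ih =>
    have h1 : Fin.init (n := m + n) (α := fun _ => ℝ) (Fin.append (m := m) (n := n + 1) s t) =
        Fin.append s (Fin.init t) := by
      ext i
      revert i
      refine fin_add_forall.2 ⟨fun i => ?_, fun i => ?_⟩
      · exact (Fin.append_left s t i).trans (Fin.append_left s (Fin.init t) i).symm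
      · exact (Fin.append_right s t i.castSucc).trans (Fin.append_right s (Fin.init t) i).symm
    have h2 : Fin.append (m := m) (n := n + 1) s t (Fin.last (m + n)) = t (Fin.last n) :=
      Fin.append_right s t (Fin.last n)
    rw [row_succ γ t, ← par_ad_assoc (by simp) (by simp) (by simp), ih]
    refine ((row_succ (n := m + n) (β + γ) (Fin.append (m := m) (n := n + 1) s t)).trans ?_).symm
    rw [h1, h2]

/-! ### Pulling affine functionals back along morphisms -/

/-- Precomposition with `f` acts on affine functionals in the way that the affine part of the
Gaussian map `g` does. -/
def Pulls {m n : ℕ} (f : gqa.Hom m n) (g : GaussMap m n) : Prop :=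
  ∀ (β : ℝ) (s : Fin n → ℝ),
    (⟨m, n, f⟩ : gqa.Arrow) ⨟ row β s = row (β + s ⬝ᵥ g.b) (s ᵥ* g.A)

theorem Pulls.idn (n : ℕ) : Pulls (gqa.id n) (gauss.id n) := by
  intro β s
  have h : (gauss.id n : GaussMap n n) = .ofAffine 1 0 := rfl
  simp [h, GaussMap.ofAffine, mk_id]

theorem Pulls.comp {m n k : ℕ} {f : gqa.Hom m n} {g : gqa.Hom n k} {f' : GaussMap m n}
    {g' : GaussMap n k} (hf : Pulls f f') (hg : Pulls g g') :
    Pulls (gqa.comp f g) (f'.comp g') := by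
  intro β s
  rw [mk_comp, assoc_seq rfl rfl, hg, hf]
  simp only [GaussMap.comp, Matrix.vecMul_vecMul, dotProduct_add, Matrix.dotProduct_mulVec]
  congr 1
  ring

theorem append_vecMul_directSum {m n m' n' : ℕ} (M : Matrix (Fin n) (Fin m) ℝ)
    (N : Matrix (Fin n') (Fin m') ℝ) (v : Fin n → ℝ) (w : Fin n' → ℝ) :
    Fin.append v w ᵥ* directSum M N = Fin.append (v ᵥ* M) (w ᵥ* N) := by
  rw [← Matrix.mulVec_transpose, directSum_transpose, directSum_mulVec, Matrix.mulVec_transpose,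
    Matrix.mulVec_transpose]

theorem append_dotProduct_append {m n : ℕ} (v v' : Fin m → ℝ) (w w' : Fin n → ℝ) :
    Fin.append v w ⬝ᵥ Fin.append v' w' = v ⬝ᵥ v' + w ⬝ᵥ w' := by
  simp [dotProduct, Fin.sum_univ_add]

theorem exists_append {m n : ℕ} {α : Type*} (s : Fin (m + n) → α) :
    ∃ (u : Fin m → α) (v : Fin n → α), s = Fin.append u v :=
  ⟨fun i => s (Fin.castAdd n i), fun i => s (Fin.natAdd m i), (Fin.append_castAdd_natAdd).symm⟩

theorem Pulls.tensor {m n m' n' : ℕ} {f : gqa.Hom m n} {g : gqa.Hom m' n'} {f' : GaussMap m n}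
    {g' : GaussMap m' n'} (hf : Pulls f f') (hg : Pulls g g') :
    Pulls (gqa.tensor f g) (f'.tensor g') := by
  intro β s
  obtain ⟨u, v, rfl⟩ := exists_append s
  rw [show row β (Fin.append u v) = row β u ⊠ row 0 v ⨟ ad by rw [row_append, add_zero],
    mk_tensor, ← assoc_seq rfl rfl, par_seq_par rfl rfl, hf, hg, row_append]
  simp only [GaussMap.tensor, append_vecMul_directSum, append_dotProduct_append]
  congr 1
  ring

theorem append_vecMul_swapMatrix {m n : ℕ} (v : Fin m → ℝ) (w : Fin n → ℝ) :
    Fin.append v w ᵥ* swapMatrix n m = Fin.append w v := by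
  rw [← Matrix.mulVec_transpose, swapMatrix_transpose, swapMatrix_mulVec]

theorem Pulls.sw (m n : ℕ) : Pulls (gqa.symm m n) (gauss.symm m n) := by
  intro β s
  obtain ⟨u, v, rfl⟩ := exists_append s
  have h : (gauss.symm m n : GaussMap _ _) = .ofAffine (swapMatrix m n) 0 := rfl
  have h2 := par_ad_comm (f := row 0 v) (g := row β u) rfl rfl
  rw [row_append, row_append, row_dom, row_dom] at h2
  simp only [add_zero, zero_add] at h2
  simp only [h, GaussMap.ofAffine, append_vecMul_swapMatrix, mk_symm, dotProduct_zero, add_zero]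
  exact h2.symm

theorem row_one (β : ℝ) (s : Fin 1 → ℝ) : row β s = (on ⨟ sc β) ⊠ sc (s 0) ⨟ ad := by
  rw [row_succ, row_zero]
  rfl

theorem const_par_zr (β : ℝ) : (on ⨟ sc β) ⊠ zr ⨟ ad = on ⨟ sc β := by
  have h : (on ⨟ sc β) ⊠ zr = (on ⨟ sc β) ⨟ I 1 ⊠ zr := by
    have := par_seq_par (C := gqa) (f := on ⨟ sc β) (g := I 1) (f' := I 0) (g' := zr)
      (by simp) rfl
    rw [par_idn_zero] at this
    rw [this, seq_idn (by simp), idn_seq (by simp)]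
  rw [h, assoc_seq (by simp) (by simp), ad_zr, seq_idn (by simp)]

theorem row_two (β : ℝ) (s : Fin 2 → ℝ) :
    row β s = (on ⨟ sc β) ⊠ (sc (s 0) ⊠ sc (s 1) ⨟ ad) ⨟ ad := by
  rw [row_succ, row_one, par_ad_assoc (by simp) (by simp) (by simp)]
  rfl

/-- Precomposition moves past the constant term. -/
theorem seq_const_par {f g : gqa.Arrow} (β : ℝ) (h : f.cod = g.dom) (hg : g.cod = 1) :
    f ⨟ ((on ⨟ sc β) ⊠ g ⨟ ad) = (on ⨟ sc β) ⊠ (f ⨟ g) ⨟ ad := by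
  have e : f ⨟ (on ⨟ sc β) ⊠ g = (on ⨟ sc β) ⊠ (f ⨟ g) := by
    have := par_seq_par (C := gqa) (f := I 0) (g := on ⨟ sc β) (f' := f) (g' := g)
      (by simp) h
    rwa [idn_zero_par, idn_seq (by simp)] at this
  rw [← assoc_seq (by simp [h]) (by simp [hg]), e]

theorem Pulls.copy : Pulls (cls copy) (gaussInterp .copy) := by
  intro β s
  change cp ⨟ row β s = _
  rw [row_two, seq_const_par _ (by simp) (by simp), ← assoc_seq (by simp) (by simp), cp_sc_ad,
    row_one]
  simp [gaussInterp, GaussMap.ofAffine, Matrix.vecMul, dotProduct, Fin.sum_univ_two]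

theorem Pulls.discard : Pulls (cls discard) (gaussInterp .discard) := by
  intro β s
  change dc ⨟ row β s = _
  rw [row_one]
  simp only [gaussInterp, GaussMap.ofAffine, Matrix.vecMul_zero, Pi.zero_apply, dotProduct_zero,
    add_zero]
  rw [sc_zero, ← seq_const_par _ (by simp) (by simp), const_par_zr, row_zero]

theorem Pulls.add : Pulls (cls add) (gaussInterp .add) := by
  intro β s
  change ad ⨟ row β s = _
  rw [row_one, seq_const_par _ (by simp) (by simp), ad_sc, row_two]
  simp [gaussInterp, GaussMap.ofAffine, Matrix.vecMul, dotProduct]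

theorem Pulls.zero : Pulls (cls zero) (gaussInterp .zero) := by
  intro β s
  change zr ⨟ row β s = _
  rw [row_one, seq_const_par _ (by simp) (by simp), zr_sc, row_zero, const_par_zr]
  simp [gaussInterp, GaussMap.ofAffine]

theorem Pulls.scalar (k : ℝ) : Pulls (cls (scalar k)) (gaussInterp (.scalar k)) := by
  intro β s
  change sc k ⨟ row β s = _
  rw [row_one, seq_const_par _ (by simp) (by simp), sc_sc, row_one]
  simp [gaussInterp, GaussMap.ofAffine, Matrix.vecMul, dotProduct, mul_comm]

theorem Pulls.one : Pulls (cls one) (gaussInterp .one) := by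
  intro β s
  change on ⨟ row β s = _
  rw [row_one, seq_const_par _ (by simp) (by simp), row_zero, ← par_seq_par (by simp) (by simp),
    ← on_cp, assoc_seq (by simp) (by simp), assoc_seq (by simp) (by simp),
    ← assoc_seq (f := cp) (by simp) (by simp), cp_sc_ad]
  simp [gaussInterp, GaussMap.ofAffine, dotProduct]

end CausalGQA

/-! ### Interpretation of free props -/

namespace SMT

/-- Extension of an assignment of the generators to all terms. -/
def eval {T : SMT} {C : PropCat} (v : ∀ {m n : ℕ}, T.Op m n → C.Hom m n) :
    ∀ {m n : ℕ}, Term T.Op m n → C.Hom m n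
  | _, _, .gen o => v o
  | _, _, .id n => C.id n
  | _, _, .swap m n => C.symm m n
  | _, _, .seq c d => C.comp (eval v c) (eval v d)
  | _, _, .par c d => C.tensor (eval v c) (eval v d)

variable {T : SMT} {C : PropCat} (v : ∀ {m n : ℕ}, T.Op m n → C.Hom m n)

theorem eval_castHom {m n m' n' : ℕ} (hm : m = m') (hn : n = n') (c : Term T.Op m n) :
    eval (C := C) v (castHom hm hn c) = castHom hm hn (eval v c) := by subst hm hn; rfl

theorem eval_eq_of_provable
    (hv : ∀ {m n : ℕ} {c d : Term T.Op m n}, T.Eqn c d → eval (C := C) v c = eval v d)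
    {m n : ℕ} {c d : Term T.Op m n} (h : T.Provable c d) : eval (C := C) v c = eval v d := by
  induction h with
  | eqn h => exact hv h
  | refl => rfl
  | symm _ ih => exact ih.symm
  | trans _ _ ih ih' => exact ih.trans ih'
  | seq_congr _ _ ih ih' => simp only [eval, ih, ih']
  | par_congr _ _ ih ih' => simp only [eval, ih, ih']
  | seq_assoc => exact C.comp_assoc _ _ _
  | id_seq => exact C.id_comp _
  | seq_id => exact C.comp_id _
  | par_assoc => rw [eval_castHom]; exact C.tensor_assoc _ _ _
  | id_par => rw [eval_castHom]; exact C.id_tensor _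
  | par_id => rw [eval_castHom]; exact C.tensor_id _
  | id_par_id => exact C.id_tensor_id _ _
  | interchange => exact C.interchange _ _ _ _
  | swap_natural => exact C.symm_natural _ _
  | swap_swap => exact C.symm_symm _ _
  | hexagon m n k =>
    rw [eval_castHom]
    simp only [eval]
    rw [eval_castHom]
    exact C.hexagon m n k

/-- An assignment of the generators that satisfies the equations of the theory extends to the
free prop. -/
def lift (hv : ∀ {m n : ℕ} {c d : Term T.Op m n}, T.Eqn c d → eval (C := C) v c = eval v d) :
    PropHom T.freeProp C where
  map f := Quotient.lift (eval (C := C) v) (fun _ _ h => eval_eq_of_provable v hv h) f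
  map_id _ := rfl
  map_comp := by rintro m n k ⟨f⟩ ⟨g⟩; rfl
  map_tensor := by rintro m n m' n' ⟨f⟩ ⟨g⟩; rfl
  map_symm _ _ := rfl

/-- Morphisms out of a free prop are determined by the generators. -/
theorem map_mk_eq_eval {F : PropHom T.freeProp C} (hF : F.Extends v) {m n : ℕ}
    (c : Term T.Op m n) : F.map (FreeHom.mk T c) = eval (C := C) v c := by
  induction c with
  | gen o => exact hF o
  | id n => exact F.map_id n
  | swap m n => exact F.map_symm m n
  | seq c d ih ih' =>
    exact (F.map_comp (FreeHom.mk T c) (FreeHom.mk T d)).trans (congrArg₂ _ ih ih')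
  | par c d ih ih' =>
    exact (F.map_tensor (FreeHom.mk T c) (FreeHom.mk T d)).trans (congrArg₂ _ ih ih')

end SMT

/-- A bijective morphism of props is an isomorphism. -/
theorem PropHom.isIso_of_bijective {C D : PropCat} (F : PropHom C D)
    (hi : ∀ {m n : ℕ} {f g : C.Hom m n}, F.map f = F.map g → f = g)
    (hs : ∀ {m n : ℕ} (g : D.Hom m n), ∃ f : C.Hom m n, F.map f = g) : F.IsIso := by
  choose G hG using @hs
  refine ⟨⟨fun g => G g, fun n => hi ?_, fun f g => hi ?_, fun f g => hi ?_, fun m n => hi ?_⟩,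
    fun f => hi (hG _), fun g => hG g⟩
  · rw [hG, F.map_id]
  · rw [hG, F.map_comp, hG, hG]
  · rw [hG, F.map_tensor, hG, hG]
  · rw [hG, F.map_symm]

/-! ### Soundness of the interpretation as Gaussian maps -/

namespace GaussMap

/-- The affine part of a Gaussian map, as a function on vectors. -/
def apply {m n : ℕ} (g : GaussMap m n) (x : Fin m → ℝ) : Fin n → ℝ := g.A *ᵥ x + g.b

theorem ext_apply {m n : ℕ} {f g : GaussMap m n} (h : ∀ x, f.apply x = g.apply x)
    (hc : f.cov = g.cov) : f = g := by
  have hb : f.b = g.b := by simpa [apply] using h 0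
  ext1
  · refine Matrix.mulVec_injective (funext fun x => ?_)
    simpa [apply, hb] using h x
  · exact hb
  · exact hc

theorem apply_ofAffine {m n : ℕ} (A : Matrix (Fin n) (Fin m) ℝ) (b : Fin n → ℝ)
    (x : Fin m → ℝ) : (ofAffine A b).apply x = A *ᵥ x + b := rfl

theorem apply_comp {m n k : ℕ} (f : GaussMap m n) (g : GaussMap n k) (x : Fin m → ℝ) :
    (f.comp g).apply x = g.apply (f.apply x) := by
  simp [apply, comp, Matrix.mulVec_add, add_assoc]

theorem apply_tensor_append {m n m' n' : ℕ} (f : GaussMap m n) (g : GaussMap m' n')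
    (x : Fin m → ℝ) (y : Fin m' → ℝ) :
    (f.tensor g).apply (Fin.append x y) = Fin.append (f.apply x) (g.apply y) := by
  simp [apply, tensor, directSum_mulVec, append_add]

theorem apply_tensor {m n m' n' : ℕ} (f : GaussMap m n) (g : GaussMap m' n')
    (x : Fin (m + m') → ℝ) : (f.tensor g).apply x =
      Fin.append (f.apply fun i => x (Fin.castAdd m' i)) (g.apply fun i => x (Fin.natAdd m i)) := by
  rw [← apply_tensor_append, Fin.append_castAdd_natAdd]

theorem apply_id (n : ℕ) (x : Fin n → ℝ) : (gauss.id n : GaussMap n n).apply x = x := by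
  simp [gauss, apply_ofAffine]

theorem apply_symm_append {m n : ℕ} (x : Fin m → ℝ) (y : Fin n → ℝ) :
    (gauss.symm m n : GaussMap _ _).apply (Fin.append x y) = Fin.append y x := by
  simp [gauss, apply_ofAffine, swapMatrix_mulVec]

theorem apply_symm (m n : ℕ) (x : Fin (m + n) → ℝ) :
    (gauss.symm m n : GaussMap _ _).apply x =
      Fin.append (fun i => x (Fin.natAdd m i)) (fun i => x (Fin.castAdd n i)) := by
  rw [← apply_symm_append, Fin.append_castAdd_natAdd]

theorem apply_castHom {m n m' n' : ℕ} (hm : m = m') (hn : n = n')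
    (g : GaussMap m n) (x : Fin m' → ℝ) (i : Fin n') :
    (castHom hm hn g).apply x i = g.apply (fun j => x (Fin.cast hm j)) (Fin.cast hn.symm i) := by
  subst hm hn; rfl

/-- The covariance of a composite of Gaussian maps without noise vanishes. -/
theorem comp_cov_eq_zero {m n k : ℕ} {f : GaussMap m n} {g : GaussMap n k} (hf : f.cov = 0)
    (hg : g.cov = 0) : (f.comp g).cov = 0 := by
  simp [comp, hf, hg]

theorem tensor_cov_eq_zero {m n m' n' : ℕ} {f : GaussMap m n} {g : GaussMap m' n'}
    (hf : f.cov = 0) (hg : g.cov = 0) : (f.tensor g).cov = 0 := by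
  simp [tensor, hf, hg, directSum_zero]

end GaussMap

namespace CausalGQA

open PropCat.Arrow GaussMap

local notation "I" => PropCat.Arrow.idn gqa
local notation "S" => PropCat.Arrow.sw gqa

/-- The Gaussian map denoted by a term. -/
abbrev den {m n : ℕ} (c : Tm m n) : GaussMap m n :=
  SMT.eval (T := causalGQA) (C := gauss) gaussInterp c

theorem den_seq {m n k : ℕ} (c : Tm m n) (d : Tm n k) : den (c ⨾ d) = (den c).comp (den d) := rfl
theorem den_par {m n m' n' : ℕ} (c : Tm m n) (d : Tm m' n') :
    den (c ⊞ₜ d) = (den c).tensor (den d) := rfl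

theorem apply_copy (x : Fin 1 → ℝ) : (den copy).apply x = ![x 0, x 0] := by
  change (ofAffine !![1; 1] 0).apply x = _
  ext i; fin_cases i <;> simp [apply_ofAffine, dotProduct]

theorem apply_discard (x : Fin 1 → ℝ) : (den discard).apply x = ![] := Subsingleton.elim _ _

theorem apply_add (x : Fin 2 → ℝ) : (den add).apply x = ![x 0 + x 1] := by
  change (ofAffine !![1, 1] 0).apply x = _
  ext i; fin_cases i; simp [apply_ofAffine, dotProduct]

theorem apply_zero (x : Fin 0 → ℝ) : (den zero).apply x = ![0] := by
  change (ofAffine 0 0).apply x = _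
  ext i; fin_cases i; simp [apply_ofAffine]

theorem apply_scalar (k : ℝ) (x : Fin 1 → ℝ) : (den (scalar k)).apply x = ![k * x 0] := by
  change (ofAffine !![k] 0).apply x = _
  ext i; fin_cases i; simp [apply_ofAffine, dotProduct]

theorem apply_one (x : Fin 0 → ℝ) : (den one).apply x = ![1] := by
  change (ofAffine 0 ![1]).apply x = _
  ext i; fin_cases i; simp [apply_ofAffine]

theorem apply_normal (x : Fin 0 → ℝ) : (den normal).apply x = ![0] := by
  change (GaussMap.mk 0 0 1 Matrix.PosSemidef.one : GaussMap 0 1).apply x = _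
  ext i; fin_cases i; simp [apply]

theorem apply_wire (x : Fin 1 → ℝ) : (den wire).apply x = x := apply_id 1 x
theorem apply_empty (x : Fin 0 → ℝ) : (den empty).apply x = x := apply_id 0 x
theorem apply_cross (x : Fin 2 → ℝ) : (den cross).apply x = ![x 1, x 0] := by
  refine (apply_symm 1 1 x).trans ?_
  ext i; fin_cases i <;> rfl

theorem append_one_one (x y : Fin 1 → ℝ) :
    (Fin.append x y : Fin 2 → ℝ) = ![x 0, y 0] := by
  ext i; fin_cases i <;> rfl

theorem append_two_two (x y : Fin 2 → ℝ) :
    (Fin.append x y : Fin 4 → ℝ) = ![x 0, x 1, y 0, y 1] := by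
  ext i; fin_cases i <;> rfl

theorem apply_crossMid (x : Fin 4 → ℝ) : (den crossMid).apply x = ![x 0, x 2, x 1, x 3] := by
  have h : ∀ x : Fin 3 → ℝ, (den (wire ⊞ₜ cross)).apply x = ![x 0, x 2, x 1] := by
    intro x
    refine (apply_tensor (den wire) (den cross) x).trans ?_
    rw [apply_wire, apply_cross]
    ext i; fin_cases i <;> rfl
  refine (apply_tensor (den (wire ⊞ₜ cross)) (den wire) x).trans ?_
  rw [h, apply_wire]
  ext i; fin_cases i <;> rfl

theorem apply_mat2 (a b c d : ℝ) (x : Fin 2 → ℝ) :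
    (den (mat2 a b c d)).apply x = ![a * x 0 + b * x 1, c * x 0 + d * x 1] := by
  have h1 : (den (copy ⊞ₜ copy)).apply x = ![x 0, x 0, x 1, x 1] := by
    refine (apply_tensor (den copy) (den copy) x).trans ?_
    rw [apply_copy, apply_copy, append_two_two]
    rfl
  have h2 : ∀ (a b : ℝ) (y : Fin 2 → ℝ), (den (scalar a ⊞ₜ scalar b ⨾ add)).apply y =
      ![a * y 0 + b * y 1] := by
    intro a b y
    refine (apply_comp _ _ y).trans ?_
    rw [apply_add]
    have : ((den (scalar a)).tensor (den (scalar b))).apply y = ![a * y 0, b * y 1] := by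
      rw [apply_tensor, apply_scalar, apply_scalar]
      exact append_one_one _ _
    exact congrArg (fun z : Fin 2 → ℝ => ![z 0 + z 1]) this
  refine (apply_comp (den (copy ⊞ₜ copy ⨾ crossMid)) _ x).trans ?_
  rw [show (den (copy ⊞ₜ copy ⨾ crossMid)).apply x = ![x 0, x 1, x 0, x 1] from
    (apply_comp (den (copy ⊞ₜ copy)) (den crossMid) x).trans (by rw [h1, apply_crossMid]; rfl)]
  refine (apply_tensor (den (scalar a ⊞ₜ scalar b ⨾ add)) (den (scalar c ⊞ₜ scalar d ⨾ add))
    _).trans ?_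
  rw [h2, h2]
  ext i; fin_cases i <;> rfl

/-- A term is noiseless if the generators occurring in it denote Gaussian maps without noise. -/
def Noiseless : ∀ {m n : ℕ}, Tm m n → Prop
  | _, _, .gen o => (gaussInterp o).cov = 0
  | _, _, .id _ => True
  | _, _, .swap _ _ => True
  | _, _, .seq c d => Noiseless c ∧ Noiseless d
  | _, _, .par c d => Noiseless c ∧ Noiseless d

theorem Noiseless.cov_eq_zero {m n : ℕ} {c : Tm m n} (h : Noiseless c) : (den c).cov = 0 := by
  induction c with
  | gen o => exact h
  | id n => rfl
  | swap m n => rfl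
  | seq c d ih ih' => exact comp_cov_eq_zero (ih h.1) (ih' h.2)
  | par c d ih ih' => exact tensor_cov_eq_zero (ih h.1) (ih' h.2)

theorem noiseless_mat2 (a b c d : ℝ) : Noiseless (mat2 a b c d) := by
  simp [mat2, Noiseless, copy, crossMid, wire, cross, scalar, add, gaussInterp, ofAffine]

theorem mat2_A_mul_transpose (φ : ℝ) :
    (den (mat2 (Real.cos φ) (-Real.sin φ) (Real.sin φ) (Real.cos φ))).A *
      (den (mat2 (Real.cos φ) (-Real.sin φ) (Real.sin φ) (Real.cos φ))).Aᵀ = 1 := by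
  have hb : (den (mat2 (Real.cos φ) (-Real.sin φ) (Real.sin φ) (Real.cos φ))).b = 0 := by
    have := apply_mat2 (Real.cos φ) (-Real.sin φ) (Real.sin φ) (Real.cos φ) 0
    simp only [apply, Matrix.mulVec_zero, zero_add, Pi.zero_apply, mul_zero, add_zero] at this
    rw [this]
    simp
  have hA : (den (mat2 (Real.cos φ) (-Real.sin φ) (Real.sin φ) (Real.cos φ))).A =
      !![Real.cos φ, -Real.sin φ; Real.sin φ, Real.cos φ] := by
    refine Matrix.mulVec_injective (funext fun x => ?_)
    have := apply_mat2 (Real.cos φ) (-Real.sin φ) (Real.sin φ) (Real.cos φ) x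
    rw [apply, hb, add_zero] at this
    rw [this]
    ext i; fin_cases i <;> simp [dotProduct]
  have h := Real.sin_sq_add_cos_sq φ
  rw [hA]
  ext i j
  fin_cases i <;> fin_cases j <;> simp [Matrix.mul_apply, Fin.sum_univ_two] <;> linarith

theorem den_eq_of_ax {m n : ℕ} {c d : Tm m n} (h : Ax c d) : den c = den d := by
  induction h with
  | normal_del =>
    exact ext_apply (fun _ => Subsingleton.elim _ _) (Subsingleton.elim _ _)
  | normal_rot φ hφ =>
    have hb : ∀ x, (den (normal ⊞ₜ normal)).apply x = 0 := fun x => by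
      refine (apply_tensor (den normal) (den normal) x).trans ?_
      rw [apply_normal, apply_normal]
      ext i; fin_cases i <;> rfl
    have hc : (den (normal ⊞ₜ normal)).cov = 1 := directSum_one 1 1
    refine ext_apply (fun x => ?_) ?_
    · refine (apply_comp (den (normal ⊞ₜ normal)) (den (mat2 _ _ _ _)) x).trans ?_
      rw [hb, apply_mat2]
      simp
    · have h := (noiseless_mat2 (Real.cos φ) (-Real.sin φ) (Real.sin φ) (Real.cos φ)).cov_eq_zero
      rw [hc]
      change _ * (den (normal ⊞ₜ normal)).cov * _ + _ = _
      rw [hc, h, Matrix.mul_one, mat2_A_mul_transpose, add_zero]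
  | _ =>
    refine ext_apply (fun x => ?_) ?_
    · ext i
      revert i
      simp only [den_seq, apply_comp, apply_add, apply_copy, apply_zero, apply_discard,
        apply_scalar, apply_one, apply_wire, apply_cross, apply_empty]
      try simp only [den_par, apply_tensor, apply_add, apply_copy, apply_zero, apply_discard,
        apply_scalar, apply_one, apply_wire, apply_crossMid]
      try simp [Fin.forall_fin_succ, Fin.append, Fin.addCases]
      try ring
    · rw [Noiseless.cov_eq_zero, Noiseless.cov_eq_zero] <;>
        simp [Noiseless, copy, crossMid, wire, cross, scalar, add, discard, zero, one, empty,
          gaussInterp, ofAffine]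

/-- The interpretation of causal graphical quadratic algebra in Gaussian maps. -/
def interp : PropHom gqa gauss := SMT.lift (C := gauss) gaussInterp den_eq_of_ax

/-! ### Deterministic morphisms -/

/-- The Gaussian map denoted by a morphism of causal graphical quadratic algebra. -/
def sem {m n : ℕ} (f : gqa.Hom m n) : GaussMap m n := interp.map f

theorem sem_comp {m n k : ℕ} (f : gqa.Hom m n) (g : gqa.Hom n k) :
    sem (gqa.comp f g) = (sem f).comp (sem g) :=
  interp.map_comp f g

theorem sem_tensor {m n m' n' : ℕ} (f : gqa.Hom m n) (g : gqa.Hom m' n') :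
    sem (gqa.tensor f g) = (sem f).tensor (sem g) :=
  interp.map_tensor f g

theorem sem_id (n : ℕ) : sem (gqa.id n) = gauss.id n := rfl

theorem sem_symm (m n : ℕ) : sem (gqa.symm m n) = gauss.symm m n := rfl

theorem sem_cls {m n : ℕ} (c : Tm m n) : sem (cls c) = den c := rfl

theorem sem_castHom {m n m' n' : ℕ} (hm : m = m') (hn : n = n') (f : gqa.Hom m n) :
    sem (castHom hm hn f) = castHom hm hn (sem f) := by
  subst hm hn; rfl

/-- A morphism is deterministic if it can be copied and discarded, denotes an affine map, and
pulls affine functionals back in the way this affine map does. -/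
structure IsDet {m n : ℕ} (f : gqa.Hom m n) : Prop where
  copyable : Copyable ⟨m, n, f⟩
  cov : (sem f).cov = 0
  pulls : Pulls f (sem f)

namespace IsDet

theorem idn (n : ℕ) : IsDet (gqa.id n) := ⟨Copyable.idn n, rfl, Pulls.idn n⟩

theorem symm (m n : ℕ) : IsDet (gqa.symm m n) := ⟨Copyable.sw m n, rfl, Pulls.sw m n⟩

theorem comp {m n k : ℕ} {f : gqa.Hom m n} {g : gqa.Hom n k} (hf : IsDet f) (hg : IsDet g) :
    IsDet (gqa.comp f g) where
  copyable := by rw [mk_comp]; exact hf.copyable.seq hg.copyable rfl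
  cov := by rw [sem_comp]; exact comp_cov_eq_zero hf.cov hg.cov
  pulls := by rw [sem_comp]; exact hf.pulls.comp hg.pulls

theorem tensor {m n m' n' : ℕ} {f : gqa.Hom m n} {g : gqa.Hom m' n'} (hf : IsDet f)
    (hg : IsDet g) : IsDet (gqa.tensor f g) where
  copyable := hf.copyable.par hg.copyable
  cov := by rw [sem_tensor]; exact tensor_cov_eq_zero hf.cov hg.cov
  pulls := by rw [sem_tensor]; exact hf.pulls.tensor hg.pulls

theorem castHom {m n m' n' : ℕ} (hm : m = m') (hn : n = n') {f : gqa.Hom m n} (hf : IsDet f) :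
    IsDet (castHom hm hn f) := by
  subst hm hn; exact hf

theorem copy : IsDet (cls copy) := ⟨Copyable.cp, rfl, Pulls.copy⟩
theorem discard : IsDet (cls discard) := ⟨Copyable.dc, rfl, Pulls.discard⟩
theorem add : IsDet (cls add) := ⟨Copyable.ad, rfl, Pulls.add⟩
theorem zero : IsDet (cls zero) := ⟨Copyable.zr, rfl, Pulls.zero⟩
theorem scalar (k : ℝ) : IsDet (cls (scalar k)) := ⟨Copyable.sc k, rfl, Pulls.scalar k⟩
theorem one : IsDet (cls one) := ⟨Copyable.on, rfl, Pulls.one⟩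

theorem rowHom (β : ℝ) : ∀ {n : ℕ} (s : Fin n → ℝ), IsDet (rowHom β n s)
  | 0, _ => one.comp (scalar β)
  | _ + 1, s => ((rowHom β (Fin.init s)).tensor (scalar _)).comp add

theorem dupHom : ∀ n : ℕ, IsDet (dupHom n)
  | 0 => idn 0
  | n + 1 => ((dupHom n).tensor copy).comp
      ((((idn n).tensor (symm n 1)).tensor (idn 1)).castHom _ _)

theorem delHom : ∀ n : ℕ, IsDet (delHom n)
  | 0 => idn 0
  | n + 1 => (delHom n).tensor discard

end IsDet

theorem row_zero_zero (n : ℕ) : row 0 (0 : Fin n → ℝ) = del n ⨟ zr := by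
  induction n with
  | zero =>
    rw [row_zero, sc_zero, ← assoc_seq (by simp) (by simp), on_dc, del_zero]
  | succ n ih =>
    have h : Fin.init (0 : Fin (n + 1) → ℝ) = 0 := rfl
    rw [row_succ, h, ih, Pi.zero_apply, sc_zero, ← par_seq_par (by simp) (by simp), ← del_succ,
      assoc_seq (by simp) (by simp)]
    congr 1
    have h2 : zr ⊠ zr = zr ⨟ I 1 ⊠ zr := by
      have h3 := par_seq (C := gqa) (f := I 0) (g := zr) zr (by simp)
      rwa [idn_seq (by simp), par_idn_zero] at h3
    rw [h2, assoc_seq (by simp) (by simp), ad_zr, seq_idn (by simp)]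

/-- The projection to the last wire is an affine functional. -/
theorem del_par_wire (n : ℕ) :
    del n ⊠ I 1 = row 0 (Fin.snoc (α := fun _ => ℝ) (0 : Fin n → ℝ) 1) := by
  rw [row_succ, Fin.init_snoc, Fin.snoc_last, sc_one, row_zero_zero, seq_par_idn _ (by simp),
    assoc_seq (by simp) (by simp), zr_ad, seq_idn (by simp)]

/-- Deterministic morphisms are determined by the affine maps which they denote. -/
theorem IsDet.eq_of_sem_eq {m n : ℕ} {f g : gqa.Hom m n} (hf : IsDet f) (hg : IsDet g)
    (h : sem f = sem g) : f = g := by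
  induction n with
  | zero =>
    have hf' := hf.copyable.del
    have hg' := hg.copyable.del
    rw [del_zero, seq_idn rfl] at hf' hg'
    exact mk_inj (hf'.trans hg'.symm)
  | succ n ih =>
    have h1 : gqa.comp f (gqa.tensor (gqa.id n) (cls CausalGQA.discard)) =
        gqa.comp g (gqa.tensor (gqa.id n) (cls CausalGQA.discard)) :=
      ih (hf.comp ((idn n).tensor discard)) (hg.comp ((idn n).tensor discard))
        (by rw [sem_comp, sem_comp, h])
    have h1' : (⟨m, n + 1, f⟩ : gqa.Arrow) ⨟ I n ⊠ dc = ⟨m, n + 1, g⟩ ⨟ I n ⊠ dc := by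
      have h2 := congrArg (fun x => (⟨m, n + 0, x⟩ : gqa.Arrow)) h1
      beta_reduce at h2
      rw [mk_comp, mk_comp] at h2
      exact h2
    apply mk_inj
    -- Both pairings have the same first projection, and the second is an affine functional.
    rw [hf.copyable.eq_pair (n := n) rfl, hg.copyable.eq_pair (n := n) rfl, h1', del_par_wire,
      hf.pulls, hg.pulls, h]

/-! ### Deterministic morphisms denote all affine maps -/

theorem apply_dupHom (n : ℕ) (x : Fin n → ℝ) :
    (sem (dupHom n)).apply x = Fin.append x x := by
  induction n with
  | zero => exact funext fun i => i.elim0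
  | succ n ih =>
    rw [dupHom, sem_comp, apply_comp, sem_tensor, sem_castHom, sem_tensor,
      sem_tensor, sem_cls]
    ext i
    rw [apply_castHom]
    rw [apply_tensor, apply_tensor, apply_tensor, ih, apply_copy, sem_id, sem_id, sem_symm, apply_id, apply_id, apply_symm]
    have h2 : ∀ a : ℝ, ![a, a] = fun _ => a := fun a => by ext j; fin_cases j <;> rfl
    simp only [h2, Fin.append, Fin.addCases, Fin.castLT, Fin.subNat, Fin.val_cast,
      Fin.val_castAdd, Fin.val_natAdd, eq_rec_constant]
    split_ifs <;> first | omega | rfl | (congr 1; ext; simp; omega)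

theorem apply_rowHom (β : ℝ) {n : ℕ} (s : Fin n → ℝ) (x : Fin n → ℝ) :
    (sem (rowHom β n s)).apply x = ![β + s ⬝ᵥ x] := by
  induction n with
  | zero =>
    rw [rowHom, sem_comp, apply_comp, sem_cls, sem_cls, apply_one, apply_scalar]
    simp
  | succ n ih =>
    rw [rowHom, sem_comp, apply_comp, sem_tensor, sem_cls, sem_cls, apply_tensor,
      ih, apply_scalar, append_one_one, apply_add]
    simp only [dotProduct, Fin.sum_univ_castSucc, ← add_assoc]
    rfl

theorem exists_isDet {m n : ℕ} (A : Matrix (Fin n) (Fin m) ℝ) (b : Fin n → ℝ) :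
    ∃ f : gqa.Hom m n, IsDet f ∧ sem f = ofAffine A b := by
  suffices h : ∃ f : gqa.Hom m n, IsDet f ∧
      ∀ x, (sem f).apply x = A *ᵥ x + b by
    obtain ⟨f, hf, h⟩ := h
    exact ⟨f, hf, ext_apply h hf.cov⟩
  induction n with
  | zero => exact ⟨delHom m, .delHom m, fun _ => Subsingleton.elim _ _⟩
  | succ n ih =>
    obtain ⟨f, hf, h⟩ := ih (A.submatrix Fin.castSucc id) (Fin.init b)
    refine ⟨gqa.comp (dupHom m) (gqa.tensor f (rowHom (b (Fin.last n)) m (A (Fin.last n)))),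
      (IsDet.dupHom m).comp (hf.tensor (.rowHom _ _)), fun x => ?_⟩
    rw [sem_comp, apply_comp, apply_dupHom, sem_tensor, apply_tensor_append, h,
      apply_rowHom]
    refine funext (Fin.lastCases ?_ fun i => ?_)
    · refine (Fin.append_right _ _ (0 : Fin 1)).trans ?_
      simp [Matrix.mulVec, add_comm]
    · refine (Fin.append_left _ _ i).trans ?_
      rfl

/-! ### Dilations -/

/-- The standard normal state on `k` wires. -/
def noiseHom : ∀ k : ℕ, gqa.Hom 0 k
  | 0 => gqa.id 0
  | k + 1 => gqa.tensor (noiseHom k) (cls normal)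

/-- The standard normal state on `k` wires, as an arrow. -/
def noise (k : ℕ) : gqa.Arrow := ⟨0, k, noiseHom k⟩

@[simp] theorem noise_dom (k : ℕ) : (noise k).dom = 0 := (rfl)
@[simp] theorem noise_cod (k : ℕ) : (noise k).cod = k := (rfl)
@[simp] theorem noise_zero : noise 0 = I 0 := rfl

theorem noise_succ (k : ℕ) : noise (k + 1) = noise k ⊠ nm := rfl

theorem noise_add (k l : ℕ) : noise (k + l) = noise k ⊠ noise l := by
  induction l with
  | zero => simp
  | succ l ih => rw [← add_assoc, noise_succ, ih, noise_succ, par_assoc]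

theorem noise_one : noise 1 = nm := by
  rw [show (1 : ℕ) = 0 + 1 from rfl, noise_succ, noise_zero, idn_zero_par]

theorem noise_del (k : ℕ) : noise k ⨟ del k = I 0 := by
  induction k with
  | zero => simp
  | succ k ih =>
    rw [noise_succ, del_succ, par_seq_par (by simp) (by simp), ih, nm_dc, idn_zero_par]

theorem sem_noiseHom (k : ℕ) :
    sem (noiseHom k) = ⟨0, 0, 1, Matrix.PosSemidef.one⟩ := by
  induction k with
  | zero =>
    exact GaussMap.ext (Matrix.ext fun i => i.elim0) (funext fun i => i.elim0)
      (Matrix.ext fun i => i.elim0)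
  | succ k ih =>
    rw [noiseHom, sem_tensor, ih]
    refine GaussMap.ext (Matrix.ext fun _ i => i.elim0) ?_ (directSum_one k 1)
    change Fin.append (0 : Fin k → ℝ) (0 : Fin 1 → ℝ) = 0
    ext i; revert i; simp [fin_add_forall]

/-- An arrow is deterministic if its underlying morphism is. -/
def DetArrow (f : gqa.Arrow) : Prop := IsDet f.hom

theorem DetArrow.seq {f g : gqa.Arrow} (hf : DetArrow f) (hg : DetArrow g) (h : f.cod = g.dom) :
    DetArrow (f ⨟ g) := by
  obtain ⟨a, b, f⟩ := f
  obtain ⟨b', c, g⟩ := g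
  cases h
  rw [← mk_comp]
  exact IsDet.comp hf hg

theorem DetArrow.par {f g : gqa.Arrow} (hf : DetArrow f) (hg : DetArrow g) :
    DetArrow (f ⊠ g) := IsDet.tensor hf hg

/-- An arrow `f : m → n` has a dilation if it arises from a deterministic arrow `m + k → n` by
feeding independent standard normal noise into the last `k` inputs. -/
def HasDilation (f : gqa.Arrow) : Prop :=
  ∃ (k : ℕ) (L : gqa.Arrow), L.dom = f.dom + k ∧ L.cod = f.cod ∧ DetArrow L ∧
    f = I f.dom ⊠ noise k ⨟ L

theorem DetArrow.idn (n : ℕ) : DetArrow (I n) := IsDet.idn n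

theorem DetArrow.sw (m n : ℕ) : DetArrow (S m n) := IsDet.symm m n

theorem DetArrow.hasDilation {f : gqa.Arrow} (hf : DetArrow f) : HasDilation f :=
  ⟨0, f, rfl, rfl, hf, by simp⟩

theorem HasDilation.nm : HasDilation nm :=
  ⟨1, I 1, rfl, rfl, IsDet.idn 1, by simp [noise_one]⟩

theorem HasDilation.seq {f g : gqa.Arrow} (hf : HasDilation f) (hg : HasDilation g)
    (h : f.cod = g.dom) : HasDilation (f ⨟ g) := by
  obtain ⟨k, L, hd, hc, hL, e⟩ := hf
  obtain ⟨l, M, hd', hc', hM, e'⟩ := hg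
  have e1 : L ⨟ I g.dom ⊠ noise l = I (f.dom + k) ⊠ noise l ⨟ L ⊠ I l := by
    have h1 := par_seq_par (C := gqa) (f := L) (g := I g.dom) (f' := I 0) (g' := noise l)
      (by simp [hc, h]) (by simp)
    rw [par_idn_zero, seq_idn (by simp [hc, h]), idn_seq (by simp)] at h1
    rw [h1, par_seq_par (by simp [hd]) (by simp), idn_seq hd.symm, seq_idn (by simp)]
  have e2 : I f.dom ⊠ noise k ⨟ I (f.dom + k) ⊠ noise l = I f.dom ⊠ noise (k + l) := by
    have h1 := par_seq_par (C := gqa) (f := I f.dom ⊠ noise k) (g := I (f.dom + k)) (f' := I 0)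
      (g' := noise l) (by simp) (by simp)
    rw [par_idn_zero, seq_idn (by simp), idn_seq (by simp)] at h1
    rw [h1, noise_add, par_assoc]
  refine ⟨k + l, L ⊠ I l ⨟ M, by simp [hd, add_assoc], ?_,
    (hL.par (.idn l)).seq hM (by simp [hc, hd', h]), ?_⟩
  · rw [seq_cod (by simp [hc, hd', h]), seq_cod h, hc']
  · rw [seq_dom]
    conv_lhs => rw [e, e']
    rw [← assoc_seq (by simp [hc, hd, h]) (by simp [hd']), assoc_seq (g := L) (by simp [hd])
      (by simp [hc, h]), e1, ← assoc_seq (by simp) (by simp [hd]),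
      e2, assoc_seq (by simp [hd, add_assoc]) (by simp [hc, hd', h])]

theorem HasDilation.par {f g : gqa.Arrow} (hf : HasDilation f) (hg : HasDilation g) :
    HasDilation (f ⊠ g) := by
  obtain ⟨k, L, hd, hc, hL, e⟩ := hf
  obtain ⟨l, M, hd', hc', hM, e'⟩ := hg
  have e1 : noise k ⊠ I g.dom = I g.dom ⊠ noise k ⨟ S g.dom k := by
    rw [sw_natural (C := gqa) (f := I g.dom) (g := noise k) (a := g.dom) (b := k)
      (a' := g.dom) (b' := 0) rfl rfl rfl rfl, sw_zero_right,
      idn_seq (by simp)]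
  have e2 : I f.dom ⊠ noise k ⊠ (I g.dom ⊠ noise l) =
      I (f.dom + g.dom) ⊠ noise (k + l) ⨟ I f.dom ⊠ S g.dom k ⊠ I l := by
    have : I f.dom ⊠ noise k ⊠ (I g.dom ⊠ noise l) =
        I f.dom ⊠ (noise k ⊠ I g.dom) ⊠ noise l := by simp only [par_assoc]
    rw [this, e1, idn_par_seq _ (by simp), seq_par _ (by simp), noise_add, idn_add]
    simp only [par_assoc, noise_cod]
  refine ⟨k + l, I f.dom ⊠ S g.dom k ⊠ I l ⨟ L ⊠ M, by simp +arith, ?_,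
    (((DetArrow.idn _).par (.sw _ _)).par (.idn l)).seq
      (hL.par hM) (by simp +arith [hd, hd']), ?_⟩
  · rw [seq_cod (by simp +arith [hd, hd']), par_cod, par_cod, hc, hc']
  · rw [par_dom, ← assoc_seq (by simp +arith) (by simp +arith [hd, hd']), ← e2,
      par_seq_par (by simp [hd]) (by simp [hd']), ← e, ← e']

theorem hasDilation_arr {m n : ℕ} (c : Tm m n) : HasDilation (arr c) := by
  induction c with
  | gen o =>
    cases o with
    | copy => exact DetArrow.hasDilation IsDet.copy
    | discard => exact DetArrow.hasDilation IsDet.discard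
    | add => exact DetArrow.hasDilation IsDet.add
    | zero => exact DetArrow.hasDilation IsDet.zero
    | scalar k => exact DetArrow.hasDilation (IsDet.scalar k)
    | one => exact DetArrow.hasDilation IsDet.one
    | normal => exact .nm
  | id n => exact DetArrow.hasDilation (IsDet.idn n)
  | swap m n => exact DetArrow.hasDilation (IsDet.symm m n)
  | seq c d ih ih' => rw [arr_seq]; exact ih.seq ih' rfl
  | par c d ih ih' => exact ih.par ih'

/-- The morphism that arises from `L` by feeding standard normal noise into the last `k` inputs. -/
def dilate {m n k : ℕ} (L : gqa.Hom (m + k) n) : gqa.Hom m n :=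
  gqa.comp (m := m) (gqa.tensor (gqa.id m) (noiseHom k)) L

theorem mk_dilate {m n k : ℕ} (L : gqa.Hom (m + k) n) :
    (⟨m, n, dilate L⟩ : gqa.Arrow) = I m ⊠ noise k ⨟ ⟨m + k, n, L⟩ := mk_comp _ _

/-- The amount of noise in a dilation may be increased. -/
theorem exists_dilate_add {m n k : ℕ} {L : gqa.Hom (m + k) n} (hL : IsDet L) (l : ℕ) :
    ∃ M : gqa.Hom (m + (k + l)) n, IsDet M ∧ dilate M = dilate L := by
  refine ⟨castHom (add_assoc m k l) rfl (gqa.tensor L (delHom l)),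
    (hL.tensor (.delHom l)).castHom _ _, mk_inj ?_⟩
  rw [mk_dilate, mk_dilate, mk_castHom, noise_add, ← par_assoc]
  refine (par_seq_par (C := gqa) (f := I m ⊠ noise k) (f' := noise l) (g := ⟨m + k, n, L⟩)
    (g' := del l) (by simp) (by simp)).trans ?_
  rw [noise_del, par_idn_zero]

theorem exists_dilation {m n : ℕ} (f : gqa.Hom m n) :
    ∃ (k : ℕ) (L : gqa.Hom (m + k) n), IsDet L ∧ f = dilate L := by
  obtain ⟨c, rfl⟩ : ∃ c : Tm m n, cls c = f := Quotient.exists_rep f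
  obtain ⟨k, ⟨a, b, L⟩, hd, hc, hL, e⟩ := hasDilation_arr c
  cases hd; cases hc
  exact ⟨k, L, hL, mk_inj (e.trans (mk_dilate L).symm)⟩

/-- Any two morphisms have dilations with the same amount of noise. -/
theorem exists_dilation₂ {m n : ℕ} (f g : gqa.Hom m n) :
    ∃ (k : ℕ) (L M : gqa.Hom (m + k) n), IsDet L ∧ IsDet M ∧ f = dilate L ∧ g = dilate M := by
  obtain ⟨k, L, hL, rfl⟩ := exists_dilation f
  obtain ⟨l, M, hM, rfl⟩ := exists_dilation g
  obtain ⟨L', hL', e⟩ := exists_dilate_add hL l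
  obtain ⟨M', hM', e'⟩ : ∃ M' : gqa.Hom (m + (k + l)) n, IsDet M' ∧ dilate M' = dilate M :=
    add_comm l k ▸ exists_dilate_add hM k
  exact ⟨k + l, L', M', hL', hM', e.symm, e'.symm⟩

/-- The blocks of the linear part of `L` are the linear part of its dilation and a square root of the
covariance. -/
theorem sem_dilate {m n k : ℕ} {L : gqa.Hom (m + k) n} (hL : IsDet L) :
    (sem (dilate L)).A = (sem L).A.submatrix id (Fin.castAdd k) ∧ (sem (dilate L)).b = (sem L).b ∧
      (sem (dilate L)).cov = (sem L).A.submatrix id (Fin.natAdd m) *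
        ((sem L).A.submatrix id (Fin.natAdd m))ᵀ := by
  have h : sem (dilate L) = ((gauss.id m : GaussMap m m).tensor (sem (noiseHom k))).comp (sem L) :=
    (sem_comp _ _).trans (congrArg (GaussMap.comp · (sem L)) (sem_tensor _ _))
  rw [h, sem_noiseHom]
  refine ⟨?_, ?_, ?_⟩
  · ext i j
    change ((sem L).A * directSum (1 : Matrix (Fin m) (Fin m) ℝ)
      (0 : Matrix (Fin k) (Fin 0) ℝ)) i (Fin.castAdd 0 j) = _
    rw [Matrix.mul_apply, Fin.sum_univ_add]
    simp only [directSum_ll, directSum_rl]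
    simp [Matrix.one_apply]
  · change (sem L).A *ᵥ Fin.append (0 : Fin m → ℝ) (0 : Fin k → ℝ) + _ = _
    have : Fin.append (0 : Fin m → ℝ) (0 : Fin k → ℝ) = 0 := by
      ext i; revert i; simp [fin_add_forall]
    rw [this, Matrix.mulVec_zero, zero_add]
  · change (sem L).A * directSum (0 : Matrix (Fin m) (Fin m) ℝ) (1 : Matrix (Fin k) (Fin k) ℝ) *
      (sem L).Aᵀ + (sem L).cov = _
    rw [hL.cov, add_zero]
    ext i j
    simp [Matrix.mul_apply, Fin.sum_univ_add, Matrix.one_apply]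

/-! ### Orthogonal invariance of noise -/

/-- A square matrix fixes noise if some deterministic morphism denoting it leaves the standard
normal state unchanged. -/
def FixesNoise {k : ℕ} (U : Matrix (Fin k) (Fin k) ℝ) : Prop :=
  ∃ u : gqa.Hom k k, IsDet u ∧ sem u = ofAffine U 0 ∧ gqa.comp (noiseHom k) u = noiseHom k

namespace FixesNoise

theorem one (k : ℕ) : FixesNoise (1 : Matrix (Fin k) (Fin k) ℝ) :=
  ⟨gqa.id k, .idn k, rfl, gqa.comp_id _⟩

theorem mul {k : ℕ} {U V : Matrix (Fin k) (Fin k) ℝ} (hU : FixesNoise U) (hV : FixesNoise V) :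
    FixesNoise (U * V) := by
  obtain ⟨u, hu, hsu, hnu⟩ := hU
  obtain ⟨v, hv, hsv, hnv⟩ := hV
  refine ⟨gqa.comp v u, hv.comp hu, ?_, ?_⟩
  · rw [sem_comp, hsu, hsv]
    ext1 <;> simp [GaussMap.comp, ofAffine]
  · rw [← gqa.comp_assoc, hnv, hnu]

theorem directSum {k l : ℕ} {U : Matrix (Fin k) (Fin k) ℝ} {V : Matrix (Fin l) (Fin l) ℝ}
    (hU : FixesNoise U) (hV : FixesNoise V) : FixesNoise (directSum U V) := by
  obtain ⟨u, hu, hsu, hnu⟩ := hU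
  obtain ⟨v, hv, hsv, hnv⟩ := hV
  refine ⟨gqa.tensor u v, hu.tensor hv, ?_, mk_inj ?_⟩
  · rw [sem_tensor, hsu, hsv]
    refine GaussMap.ext rfl ?_ (directSum_zero _ _ _ _)
    change Fin.append (0 : Fin k → ℝ) (0 : Fin l → ℝ) = 0
    ext i; revert i; simp [fin_add_forall]
  · have h1 := congrArg (fun x => (⟨0, k, x⟩ : gqa.Arrow)) hnu
    have h2 := congrArg (fun x => (⟨0, l, x⟩ : gqa.Arrow)) hnv
    beta_reduce at h1 h2
    rw [mk_comp] at h1 h2 ⊢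
    change noise k ⨟ _ = noise k at h1
    change noise l ⨟ _ = noise l at h2
    change noise (k + l) ⨟ _ = noise (k + l)
    rw [noise_add, mk_tensor, par_seq_par rfl rfl, h1, h2]

end FixesNoise

theorem isDet_mat2 (a b c d : ℝ) : IsDet (cls (mat2 a b c d)) :=
  IsDet.comp (f := cls (copy ⊞ₜ copy ⨾ crossMid))
    ((IsDet.tensor (f := cls copy) (g := cls copy) .copy .copy).comp
      (g := cls crossMid) (IsDet.tensor (f := cls (wire ⊞ₜ cross)) (g := cls wire)
        (IsDet.tensor (f := cls wire) (g := cls cross) (.idn 1) (.symm 1 1)) (.idn 1)))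
    (IsDet.tensor (f := cls (scalar a ⊞ₜ scalar b ⨾ add)) (g := cls (scalar c ⊞ₜ scalar d ⨾ add))
      (IsDet.comp (f := cls (scalar a ⊞ₜ scalar b)) (g := cls add)
        (IsDet.tensor (f := cls (scalar a)) (g := cls (scalar b)) (.scalar a) (.scalar b)) .add)
      (IsDet.comp (f := cls (scalar c ⊞ₜ scalar d)) (g := cls add)
        (IsDet.tensor (f := cls (scalar c)) (g := cls (scalar d)) (.scalar c) (.scalar d)) .add))

theorem sem_mat2 (a b c d : ℝ) : sem (cls (mat2 a b c d)) = ofAffine !![a, b; c, d] 0 := by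
  refine ext_apply (fun x => ?_) (noiseless_mat2 a b c d).cov_eq_zero
  rw [sem_cls, apply_mat2, apply_ofAffine]
  ext i; fin_cases i <;> simp [dotProduct]

theorem nm_par_nm_mat2 {φ : ℝ} (hφ : φ ∈ Set.Ico 0 (2 * Real.pi)) :
    nm ⊠ nm ⨟ arr (mat2 (Real.cos φ) (-Real.sin φ) (Real.sin φ) (Real.cos φ)) = nm ⊠ nm := by
  have h := arr_eq (.normal_rot φ hφ)
  rw [arr_seq] at h
  exact h

theorem noiseHom_two : (⟨0, 2, noiseHom 2⟩ : gqa.Arrow) = nm ⊠ nm := by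
  change noise (0 + 1 + 1) = _
  rw [noise_succ, noise_succ, noise_zero, idn_zero_par]

/-- A pair of numbers with sum of squares `1` is the sine and cosine of an angle of the full
turn. -/
theorem exists_angle {c s : ℝ} (h : c ^ 2 + s ^ 2 = 1) :
    ∃ φ ∈ Set.Ico 0 (2 * Real.pi), Real.cos φ = c ∧ Real.sin φ = s := by
  have hz : ‖(⟨c, s⟩ : ℂ)‖ = 1 := by
    rw [Complex.norm_def, Complex.normSq_mk, ← sq, ← sq, h, Real.sqrt_one]
  have hz0 : (⟨c, s⟩ : ℂ) ≠ 0 := fun h0 => by simp [h0] at hz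
  refine ⟨toIcoMod Real.two_pi_pos 0 (Complex.arg ⟨c, s⟩), toIcoMod_mem_Ico' _ _, ?_, ?_⟩
  · rw [toIcoMod, zsmul_eq_mul, Real.cos_sub_int_mul_two_pi, Complex.cos_arg hz0, hz, div_one]
  · rw [toIcoMod, zsmul_eq_mul, Real.sin_sub_int_mul_two_pi, Complex.sin_arg, hz, div_one]

theorem fixesNoise_rotation {c s : ℝ} (h : c ^ 2 + s ^ 2 = 1) :
    FixesNoise !![c, -s; s, c] := by
  obtain ⟨φ, hφ, rfl, rfl⟩ := exists_angle h
  refine ⟨_, isDet_mat2 _ _ _ _, sem_mat2 _ _ _ _, mk_inj ?_⟩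
  rw [mk_comp, noiseHom_two]
  exact nm_par_nm_mat2 hφ

/-- A half turn of two independent normal variables negates the first; the second is discarded. -/
theorem fixesNoise_neg_one : FixesNoise (!![-1] : Matrix (Fin 1) (Fin 1) ℝ) := by
  have e : arr (mat2 (Real.cos Real.pi) (-Real.sin Real.pi) (Real.sin Real.pi)
      (Real.cos Real.pi)) = sc (-1) ⊠ sc (-1) := by
    have h : cls (mat2 (Real.cos Real.pi) (-Real.sin Real.pi) (Real.sin Real.pi)
        (Real.cos Real.pi)) = gqa.tensor (cls (scalar (-1))) (cls (scalar (-1))) := by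
      refine (isDet_mat2 _ _ _ _).eq_of_sem_eq ((IsDet.scalar _).tensor (.scalar _)) ?_
      refine ext_apply (fun x => ?_) ?_
      · rw [sem_cls, apply_mat2, sem_tensor, apply_tensor, sem_cls, apply_scalar, apply_scalar]
        refine Eq.trans ?_ (append_one_one _ _).symm
        simp
      · exact (noiseless_mat2 _ _ _ _).cov_eq_zero.trans
          (((IsDet.scalar (-1)).tensor (.scalar (-1))).cov).symm
    exact congrArg (fun x => (⟨2, 2, x⟩ : gqa.Arrow)) h
  have h1 := nm_par_nm_mat2 (φ := Real.pi) ⟨Real.pi_pos.le, by linarith [Real.pi_pos]⟩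
  rw [e, par_seq_par (by simp) (by simp)] at h1
  have h2 := congrArg (· ⨟ I 1 ⊠ dc) h1
  beta_reduce at h2
  rw [par_seq_par (by simp) (by simp), par_seq_par (by simp) (by simp), seq_idn (by simp),
    seq_idn (by simp), assoc_seq (f := nm) (by simp) (by simp), sc_dc, nm_dc, par_idn_zero,
    par_idn_zero] at h2
  refine ⟨cls (scalar (-1)), .scalar _, rfl, mk_inj ?_⟩
  rw [mk_comp]
  change noise 1 ⨟ sc (-1) = noise 1
  rw [noise_one, h2]

theorem single_last (n : ℕ) :
    (Pi.single (Fin.last n) 1 : Fin (n + 1) → ℝ) = Fin.append (m := n) (n := 1) 0 ![1] := by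
  ext i
  revert i
  refine fin_add_forall.2 ⟨fun i => ?_, fun i => ?_⟩
  · rw [Fin.append_left]
    exact Pi.single_eq_of_ne (Fin.castSucc_lt_last i).ne _
  · rw [Fin.append_right, Subsingleton.elim i 0]
    exact Pi.single_eq_same (M := fun _ : Fin (n + 1) => ℝ) (Fin.last n) 1

/-- The matrices fixing noise act transitively on unit vectors. -/
theorem exists_fixesNoise_mulVec (n : ℕ) (v : Fin (n + 1) → ℝ) (hv : v ⬝ᵥ v = 1) :
    ∃ U : Matrix (Fin (n + 1)) (Fin (n + 1)) ℝ, FixesNoise U ∧ Uᵀ * U = 1 ∧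
      U *ᵥ Pi.single (Fin.last n) 1 = v := by
  induction n with
  | zero =>
    have h : v 0 * v 0 = 1 := by simpa [dotProduct] using hv
    rcases mul_self_eq_one_iff.1 h with h | h
    · refine ⟨1, .one 1, by simp, ?_⟩
      ext i; fin_cases i; simp [h]
    · refine ⟨!![-1], fixesNoise_neg_one, ?_, ?_⟩
      · ext i j; fin_cases i; fin_cases j; simp [Matrix.mul_apply]
      · ext i; fin_cases i; simp [h]
  | succ n ih =>
    obtain ⟨w, t, rfl⟩ := exists_append (m := n + 1) (n := 1) v
    have hw : w ⬝ᵥ w + t 0 ^ 2 = 1 := by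
      have := append_dotProduct_append w w t t
      rw [← hv]
      refine Eq.trans ?_ this.symm
      simp [dotProduct, sq]
    have hs : Real.sqrt (w ⬝ᵥ w) ^ 2 = w ⬝ᵥ w :=
      Real.sq_sqrt (Finset.sum_nonneg fun i _ => mul_self_nonneg _)
    set s := Real.sqrt (w ⬝ᵥ w)
    obtain ⟨w₀, hw₀, hsw⟩ : ∃ w₀ : Fin (n + 1) → ℝ, w₀ ⬝ᵥ w₀ = 1 ∧ s • w₀ = w := by
      by_cases h0 : s = 0
      · refine ⟨Pi.single (Fin.last n) 1, by simp, ?_⟩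
        rw [h0, zero_pow two_ne_zero] at hs
        rw [h0, zero_smul, dotProduct_self_eq_zero.1 hs.symm]
      · refine ⟨s⁻¹ • w, ?_, smul_inv_smul₀ h0 w⟩
        rw [smul_dotProduct, dotProduct_smul, ← hs, smul_eq_mul, smul_eq_mul]
        field_simp
    obtain ⟨U, hU, hUU, hUw⟩ := ih w₀ hw₀
    -- The rotation in the last two coordinates takes the last unit vector to `(0, …, 0, s, t)`.
    have hR : (t 0) ^ 2 + (-s) ^ 2 = 1 := by rw [neg_sq, hs, ← hw]; ring
    have hRR : !![t 0, - -s; -s, t 0]ᵀ * !![t 0, - -s; -s, t 0] = 1 := by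
      ext i j
      fin_cases i <;> fin_cases j <;> simp [Matrix.mul_apply, Fin.sum_univ_two] <;>
        linarith
    obtain ⟨B, hB, hBB, hBv⟩ : ∃ B : Matrix (Fin (n + 1 + 1)) (Fin (n + 1 + 1)) ℝ,
        FixesNoise B ∧ Bᵀ * B = 1 ∧ B *ᵥ Pi.single (Fin.last (n + 1)) 1 =
          Fin.append (s • (Pi.single (Fin.last n) 1 : Fin (n + 1) → ℝ)) t := by
      refine ⟨_root_.directSum (m := n) (n := n) (m' := 2) (n' := 2) 1 !![t 0, - -s; -s, t 0],
        (FixesNoise.one n).directSum (fixesNoise_rotation hR), ?_, ?_⟩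
      · rw [directSum_transpose, directSum_mul, hRR, Matrix.transpose_one, Matrix.one_mul]
        exact directSum_one n 2
      · have h0 : (Fin.append (0 : Fin n → ℝ) (0 : Fin 1 → ℝ)) = (0 : Fin (n + 1) → ℝ) := by
          ext i; revert i; simp [fin_add_forall]
        have h1 : (Pi.single (Fin.last (n + 1)) 1 : Fin (n + 1 + 1) → ℝ) =
            Fin.append (m := n) (n := 2) 0 ![0, 1] := by
          rw [single_last, ← h0]
          refine (append_assoc_cast (n' := 1) (n'' := 1) (0 : Fin n → ℝ) 0 ![1]).trans ?_
          rw [append_one_one]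
          rfl
        have h2 : s • (Pi.single (Fin.last n) 1 : Fin (n + 1) → ℝ) =
            Fin.append (m := n) (n := 1) 0 ![s] := by
          rw [single_last]
          ext i; revert i; simp [fin_add_forall]
        have h3 : !![t 0, - -s; -s, t 0] *ᵥ ![0, 1] = ![s, t 0] := by
          ext i; fin_cases i <;> simp
        rw [h1, h2]
        refine (directSum_mulVec (m := n) (n := n) (m' := 2) (n' := 2) _ _ _ _).trans ?_
        refine Eq.trans ?_ (append_assoc_cast (n' := 1) (n'' := 1) (0 : Fin n → ℝ) ![s] t).symm
        rw [h3, append_one_one, Matrix.mulVec_zero]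
        rfl
    have hAA : (_root_.directSum U (1 : Matrix (Fin 1) (Fin 1) ℝ))ᵀ * _root_.directSum U 1 = 1 := by
      rw [directSum_transpose, directSum_mul, hUU, Matrix.transpose_one, Matrix.one_mul,
        directSum_one]
    refine ⟨_root_.directSum U (1 : Matrix (Fin 1) (Fin 1) ℝ) * B,
      (hU.directSum (.one 1)).mul hB, ?_, ?_⟩
    · rw [Matrix.transpose_mul, Matrix.mul_assoc, ← Matrix.mul_assoc _ _ B, hAA,
        Matrix.one_mul, hBB]
    · rw [← Matrix.mulVec_mulVec, hBv, directSum_mulVec, Matrix.mulVec_smul, hUw, hsw,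
        Matrix.one_mulVec]

/-- Orthogonal matrices fix noise. -/
theorem fixesNoise_of_orthogonal {k : ℕ} {U : Matrix (Fin k) (Fin k) ℝ} (h : Uᵀ * U = 1) :
    FixesNoise U := by
  induction k with
  | zero => rw [Subsingleton.elim U 1]; exact .one 0
  | succ k ih =>
    obtain ⟨G, hG, hGG, hGv⟩ := exists_fixesNoise_mulVec k (U *ᵥ Pi.single (Fin.last k) 1) (by
      rw [Matrix.dotProduct_mulVec, Matrix.vecMul_mulVec, h]
      simp)
    have hGG' : G * Gᵀ = 1 := mul_eq_one_comm.1 hGG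
    -- `Gᵀ * U` is orthogonal and fixes the last unit vector, so it is block diagonal.
    obtain ⟨W, hW⟩ : ∃ W, W = Gᵀ * U := ⟨_, rfl⟩
    have hWW : Wᵀ * W = 1 := by
      rw [hW, Matrix.transpose_mul, Matrix.transpose_transpose, Matrix.mul_assoc,
        ← Matrix.mul_assoc G, hGG', Matrix.one_mul, h]
    have hc : W *ᵥ Pi.single (Fin.last k) 1 = Pi.single (Fin.last k) 1 := by
      rw [hW, ← Matrix.mulVec_mulVec, ← hGv, Matrix.mulVec_mulVec, hGG, Matrix.one_mulVec]
    have hr : Wᵀ *ᵥ Pi.single (Fin.last k) 1 = Pi.single (Fin.last k) 1 := by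
      conv_lhs => rw [← hc]
      rw [Matrix.mulVec_mulVec, hWW, Matrix.one_mulVec]
    have hblock : W = directSum (W.submatrix Fin.castSucc Fin.castSucc)
        (1 : Matrix (Fin 1) (Fin 1) ℝ) := by
      have hc' : ∀ i, W i (Fin.last k) = (Pi.single (Fin.last k) 1 : Fin (k + 1) → ℝ) i :=
        fun i => by rw [← hc]; simp
      have hr' : ∀ i, W (Fin.last k) i = (Pi.single (Fin.last k) 1 : Fin (k + 1) → ℝ) i :=
        fun i => by rw [← hr]; simp
      ext i j
      revert i j
      simp only [fin_add_forall, directSum_ll, directSum_lr, directSum_rl, directSum_rr]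
      refine ⟨fun i => ⟨fun j => rfl, fun j => ?_⟩, fun i => ⟨fun j => ?_, fun j => ?_⟩⟩
      · rw [Subsingleton.elim j 0]
        exact (hc' (Fin.castSucc i)).trans (Pi.single_eq_of_ne (Fin.castSucc_lt_last i).ne _)
      · rw [Subsingleton.elim i 0]
        exact (hr' (Fin.castSucc j)).trans (Pi.single_eq_of_ne (Fin.castSucc_lt_last j).ne _)
      · rw [Subsingleton.elim i 0, Subsingleton.elim j 0, Matrix.one_apply_eq]
        exact (hc' (Fin.last k)).trans (Pi.single_eq_same _ _)
    have hW' : FixesNoise W := by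
      rw [hblock] at hWW ⊢
      refine (ih ?_).directSum (.one 1)
      rw [directSum_transpose, directSum_mul] at hWW
      ext i j
      have := congrFun (congrFun hWW (Fin.castAdd 1 i)) (Fin.castAdd 1 j)
      rw [directSum_ll] at this
      rw [this]
      simp [Matrix.one_apply]
    have hU : U = G * W := by rw [hW, ← Matrix.mul_assoc, hGG', Matrix.one_mul]
    rw [hU]
    exact hG.mul hW'

/-- Two linear maps under which all vectors have images of the same norm differ by a linear
isometry: the correspondence between the ranges is an isometry, and extends to the whole space. -/
theorem exists_linearIsometry_of_norm_eq {V W : Type*} [AddCommGroup V] [Module ℝ V]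
    [NormedAddCommGroup W] [InnerProductSpace ℝ W] [FiniteDimensional ℝ W] {f g : V →ₗ[ℝ] W}
    (h : ∀ x, ‖f x‖ = ‖g x‖) : ∃ T : W →ₗᵢ[ℝ] W, ∀ x, T (f x) = g x := by
  have hker : LinearMap.ker f ≤ LinearMap.ker g := fun x hx => by
    rw [LinearMap.mem_ker] at hx ⊢
    rw [← norm_eq_zero, ← h, hx, norm_zero]
  let L₀ : LinearMap.range f →ₗ[ℝ] W :=
    ((LinearMap.ker f).liftQ g hker) ∘ₗ f.quotKerEquivRange.symm.toLinearMap
  have hL₀ : ∀ x (hx : f x ∈ LinearMap.range f), L₀ ⟨f x, hx⟩ = g x := fun x hx => by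
    simp [L₀, LinearMap.quotKerEquivRange_symm_apply_image]
  let L : LinearMap.range f →ₗᵢ[ℝ] W :=
    ⟨L₀, by rintro ⟨_, x, rfl⟩; exact (congrArg norm (hL₀ x _)).trans (h x).symm⟩
  exact ⟨L.extend, fun x => (L.extend_apply ⟨f x, x, rfl⟩).trans (hL₀ x _)⟩

/-- Matrices with the same Gram matrix of rows differ by an orthogonal matrix. -/
theorem exists_orthogonal_of_mul_transpose_eq {n k : ℕ} {M N : Matrix (Fin n) (Fin k) ℝ}
    (h : M * Mᵀ = N * Nᵀ) : ∃ U : Matrix (Fin k) (Fin k) ℝ, Uᵀ * U = 1 ∧ M * U = N := by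
  have key : ∀ (P : Matrix (Fin n) (Fin k) ℝ) x,
      ‖Matrix.toEuclideanLin Pᵀ x‖ ^ 2 = x.ofLp ⬝ᵥ (P * Pᵀ) *ᵥ x.ofLp := by
    intro P x
    have e : (Matrix.toEuclideanLin Pᵀ x).ofLp = Pᵀ *ᵥ x.ofLp := rfl
    rw [← real_inner_self_eq_norm_sq, EuclideanSpace.inner_eq_star_dotProduct, e, star_trivial,
      Matrix.mulVec_transpose, ← Matrix.mulVec_mulVec, Matrix.dotProduct_mulVec,
      Matrix.mulVec_transpose]
  obtain ⟨T, hT⟩ := exists_linearIsometry_of_norm_eq (f := Matrix.toEuclideanLin Mᵀ)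
    (g := Matrix.toEuclideanLin Nᵀ) fun x => by
      rw [← sq_eq_sq₀ (norm_nonneg _) (norm_nonneg _), key, key, h]
  set P := Matrix.toEuclideanLin.symm T.toLinearMap with hP
  have hPx : ∀ v, P *ᵥ v = (T (WithLp.toLp 2 v)).ofLp := fun v => by
    have : T (WithLp.toLp 2 v) = Matrix.toEuclideanLin P (WithLp.toLp 2 v) := by
      rw [hP, LinearEquiv.apply_symm_apply]
      rfl
    rw [this]
    rfl
  have hPP : Pᵀ * P = 1 := by
    ext i j
    have h1 : (Pᵀ * P) i j = (P *ᵥ Pi.single i 1) ⬝ᵥ (P *ᵥ Pi.single j 1) := by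
      simp [Matrix.mul_apply, dotProduct]
    have h2 := T.inner_map_map (WithLp.toLp 2 (Pi.single j 1)) (WithLp.toLp 2 (Pi.single i 1))
    rw [EuclideanSpace.inner_eq_star_dotProduct, EuclideanSpace.inner_eq_star_dotProduct] at h2
    simp only [star_trivial] at h2
    rw [h1, hPx, hPx, h2]
    simp [Matrix.one_apply, Pi.single_apply, eq_comm]
  refine ⟨Pᵀ, by rw [Matrix.transpose_transpose]; exact mul_eq_one_comm.1 hPP, ?_⟩
  have hPM : P * Mᵀ = Nᵀ := by
    refine Matrix.mulVec_injective (funext fun v => ?_)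
    rw [← Matrix.mulVec_mulVec, hPx]
    exact congrArg WithLp.ofLp (hT (WithLp.toLp 2 v))
  rw [← Matrix.transpose_transpose N, ← hPM, Matrix.transpose_mul, Matrix.transpose_transpose]

/-! ### Completeness and fullness of the interpretation -/

/-- Completeness: the orthogonal matrix relating two dilations of the same Gaussian map is absorbed
into the noise. -/
theorem sem_injective {m n : ℕ} {f g : gqa.Hom m n} (h : sem f = sem g) : f = g := by
  obtain ⟨k, L, M, hL, hM, rfl, rfl⟩ := exists_dilation₂ f g
  obtain ⟨hA, hb, hc⟩ := sem_dilate hL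
  obtain ⟨hA', hb', hc'⟩ := sem_dilate hM
  rw [← h] at hA' hb' hc'
  obtain ⟨U, hU, hLM⟩ := exists_orthogonal_of_mul_transpose_eq (hc.symm.trans hc')
  obtain ⟨u, hu, hsu, hnu⟩ := fixesNoise_of_orthogonal hU
  -- `M` arises from `L` by acting with `U` on the noise inputs.
  have e : M = gqa.comp (gqa.tensor (gqa.id m) u) L := by
    refine hM.eq_of_sem_eq (((IsDet.idn m).tensor hu).comp hL) ?_
    rw [sem_comp, sem_tensor, hsu, sem_id]
    refine GaussMap.ext ?_ ?_ ?_
    · change _ = (sem L).A * directSum 1 U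
      ext i j
      have h1 := fun j => congrFun (congrFun (hA'.symm.trans hA) i) j
      have h2 := fun j => congrFun (congrFun hLM i) j
      simp only [Matrix.submatrix_apply, id, Matrix.mul_apply] at h1 h2
      rw [Matrix.mul_apply, Fin.sum_univ_add]
      revert j
      simp only [fin_add_forall, directSum_ll, directSum_lr, directSum_rl, directSum_rr, h1, ← h2]
      simp [Matrix.one_apply]
    · have h0 : Fin.append (0 : Fin m → ℝ) (0 : Fin k → ℝ) = 0 := by
        ext i; revert i; simp [fin_add_forall]
      change _ = (sem L).A *ᵥ Fin.append (0 : Fin m → ℝ) (0 : Fin k → ℝ) + (sem L).b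
      rw [h0, Matrix.mulVec_zero, zero_add, ← hb, ← hb']
    · rw [hM.cov]
      exact (comp_cov_eq_zero (tensor_cov_eq_zero rfl rfl) hL.cov).symm
  have h1 := congrArg (fun x => (⟨0, k, x⟩ : gqa.Arrow)) hnu
  beta_reduce at h1
  rw [mk_comp] at h1
  change noise k ⨟ _ = noise k at h1
  rw [e]
  refine mk_inj ?_
  rw [mk_dilate, mk_dilate, mk_comp, mk_tensor, mk_id, ← assoc_seq (by simp) (by simp),
    ← idn_par_seq _ (by simp), h1]

-- These scopes make matrices an ordered C⋆-algebra, in which nonnegative elements factor as `Bᴴ * B`.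
open scoped MatrixOrder Matrix.Norms.L2Operator in
theorem sem_surjective {m n : ℕ} (g : GaussMap m n) : ∃ f : gqa.Hom m n, sem f = g := by
  obtain ⟨B, hB⟩ := CStarAlgebra.nonneg_iff_eq_star_mul_self.mp g.posSemidef.nonneg
  obtain ⟨L, hL, hs⟩ := exists_isDet (Matrix.of fun i => Fin.append (g.A i) (Bᵀ i)) g.b
  obtain ⟨hA, hb, hc⟩ := sem_dilate hL
  refine ⟨dilate L, GaussMap.ext ?_ ?_ ?_⟩
  · rw [hA, hs]
    ext i j
    simp [ofAffine]
  · rw [hb, hs]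
    rfl
  · have h : (Matrix.of fun i => Fin.append (g.A i) (Bᵀ i)).submatrix id (Fin.natAdd m) = Bᵀ := by
      ext i j
      simp
    rw [hc, hs, hB, Matrix.star_eq_conjTranspose, Matrix.conjTranspose_eq_transpose_of_trivial]
    simp only [ofAffine]
    rw [h, Matrix.transpose_transpose]

end CausalGQA

theorem mainTheorem2 :
    ∃ F : PropHom causalGQA.freeProp gauss,
      F.Extends (T := causalGQA) (C := gauss) gaussInterp ∧ F.IsIso ∧
      ∀ F' : PropHom causalGQA.freeProp gauss,
        F'.Extends (T := causalGQA) (C := gauss) gaussInterp → F' = F := by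
  refine ⟨CausalGQA.interp, fun _ => rfl, CausalGQA.interp.isIso_of_bijective
    CausalGQA.sem_injective CausalGQA.sem_surjective, fun F' hF' => ?_⟩
  ext m n f
  obtain ⟨c, rfl⟩ : ∃ c : CausalGQA.Tm m n, CausalGQA.cls c = f := Quotient.exists_rep f
  exact SMT.map_mk_eq_eval (T := causalGQA) (C := gauss) gaussInterp hF' c
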